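/- Let $q$ be an odd prime power, let $t$ be an odd integer, $m=2t+1\ge 5$, let $\lambda$ be a divisor of $q+1$ with $2\le\lambda<q+1$, and put $n=\frac{q^m+1}{\lambda}$. Let $\beta$ be a primitive $n$-th root of unity in an extension field of $\mathbb F_q$, and let $m_i(x)$ be the minimal polynomial of $\beta^i$ over $\mathbb F_q$. For integers $b\ge 0$ and $2\le\delta\le n$ let $\mathcal C_{(n,q,\delta,b)}\subseteq\mathbb F_q^n$ be the cyclic code (ideal of $\mathbb F_q[x]/(x^n-1)$) generated by $\operatorname{lcm}(m_b(x),m_{b+1}(x),\dots,m_{b+\delta-2}(x))$. A linear code $\mathcal C$ is LCD if $\mathcal C\cap\mathcal C^\perp=\{0\}$, where $\mathcal C^\perp$ is the Euclidean dual code. Let $\delta$ be an integer with $1\le\delta-1\le\frac{2q^{t+1}+2q-1}{\lambda}$, and put $$\epsilon=\left\lceil(\delta-1)(1-q^{-1})\right\rceil,\quad \upsilon=\left\lfloor\tfrac{q-2}{\lambda}\right\rfloor+\left\lfloor\tfrac{q}{\lambda}\right\rfloor,\quad A=\tfrac{q^{t+1}-1}{\lambda},\quad B=\tfrac{2(q^t+1)}{\lambda}$$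 (so $A$ and $B$ are integers). Then $\mathcal C_{(n,q,\delta,1)}$ is an LCD code of length $n$, dimension $k$ and minimum distance at least $\delta$, and $\mathcal C_{(n,q,\delta+1,0)}$ is an LCD code of length $n$, dimension $k-1$ and minimum distance at least $2\delta$, where $k$ is given as follows. If $\lambda=2$ and $\delta=A+bq^t+1$ for an integer $b$ with $1\le b\le\frac{q-1}{2}$, then $k=n-2m(\epsilon-\upsilon-2b)$. For all other $\delta$: (1) If $2\le\delta\le A+B$, then $$k=\begin{cases} n-2m\epsilon, & 2\le\delta\le A-\lfloor\frac{q-2}{\lambda}\rfloor;\\ n-2m\epsilon+2m\left(\delta-A+\lfloor\frac{q-2}{\lambda}\rfloor\right), & A-\lfloor\frac{q-2}{\lambda}\rfloor<\delta\le A+\lfloor\frac{q}{\lambda}\rfloor;\\ n-2m(\epsilon-\upsilon-1), & A+\lfloor\frac{q}{\lambda}\rfloor<\delta\le A+B.\end{cases}$$ (2) If $\lfloor\frac{q-3}{\lambda}\rfloor\ne 0$ and $A+B<\delta\le A+B+\lfloor\frac{q-3}{\lambda}\rfloor q^t$, then for every integer $a\in[0,\lfloor\frac{q-3}{\lambda}\rfloor-1]$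 $$k=\begin{cases} n-2m(\epsilon-\upsilon-2a-2), & A+B+aq^t<\delta\le A+(a+1)q^t;\\ n-2m(\epsilon-\upsilon-2a-3), & A+(a+1)q^t<\delta\le A+B+(a+1)q^t.\end{cases}$$ (3) If $A+B+\lfloor\frac{q-3}{\lambda}\rfloor q^t<\delta\le\frac{2q^{t+1}+2q-1}{\lambda}+1$, put $\kappa=2A-\lfloor\frac{2q-3}{\lambda}\rfloor$ and $\tau=\lceil(\kappa-1)(1-q^{-1})\rceil$. (i) If $\lfloor\frac{q-1}{\lambda}\rfloor=\lfloor\frac{q-3}{\lambda}\rfloor$, then $$k=\begin{cases} n-2m\left(\epsilon-\upsilon-2\lfloor\frac{q-1}{\lambda}\rfloor-2\right), & A+B+\lfloor\frac{q-3}{\lambda}\rfloor q^t<\delta\le\kappa;\\ n-2m\left(\tau-\upsilon-2\lfloor\frac{q-1}{\lambda}\rfloor-2\right), & \kappa<\delta\le\frac{2q^{t+1}+2q-1}{\lambda}+1.\end{cases}$$ (ii) If $\lfloor\frac{q-1}{\lambda}\rfloor=\lfloor\frac{q-3}{\lambda}\rfloor+1$, then $$k=\begin{cases} n-2m\left(\epsilon-\upsilon-2\lfloor\frac{q-1}{\lambda}\rfloor\right),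 & A+B+\lfloor\frac{q-3}{\lambda}\rfloor q^t<\delta\le A+\lfloor\frac{q-1}{\lambda}\rfloor q^t;\\ n-2m\left(\epsilon-\upsilon-2\lfloor\frac{q-1}{\lambda}\rfloor-1\right), & A+\lfloor\frac{q-1}{\lambda}\rfloor q^t<\delta\le\kappa;\\ n-2m\left(\tau-\upsilon-2\lfloor\frac{q-1}{\lambda}\rfloor-1\right), & \kappa<\delta\le\frac{2q^{t+1}+2q-1}{\lambda}+1.\end{cases}$$ -/

import Mathlib

open Polynomial

noncomputable section

/-- The polynomial `c₀ + c₁ X + ⋯ + c_{n-1} X^{n-1}` attached to a vector of length `n`. -/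
def vecToPoly (F : Type*) [Field F] (n : ℕ) : (Fin n → F) →ₗ[F] F[X] :=
  ∑ i : Fin n, (Polynomial.monomial (i : ℕ)) ∘ₗ (LinearMap.proj i : (Fin n → F) →ₗ[F] F)

/-- The identification of `F^n` with `F[X] / (X^n - 1)`. -/
def vecToQuot (F : Type*) [Field F] (n : ℕ) :
    (Fin n → F) →ₗ[F] (F[X] ⧸ Ideal.span {(X ^ n - 1 : F[X])}) :=
  (Ideal.Quotient.mkₐ F (Ideal.span {(X ^ n - 1 : F[X])})).toLinearMap ∘ₗ vecToPoly F n

/-- The code of length `n` over `F` that corresponds to the ideal generated by `g` in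
`F[X] / (X^n - 1)`. -/
def cyclicCode (F : Type*) [Field F] (n : ℕ) (g : F[X]) : Submodule F (Fin n → F) :=
  Submodule.comap (vecToQuot F n)
    ((Ideal.span {Ideal.Quotient.mk (Ideal.span {(X ^ n - 1 : F[X])}) g}).restrictScalars F)

open Classical in
/-- The (monic) least common multiple of the minimal polynomials over `F` of
`β ^ b, β ^ (b + 1), …, β ^ (b + δ - 2)`. -/
def bchGenerator (F : Type*) {K : Type*} [Field F] [Field K] [Algebra F K] (β : K) (δ b : ℕ) :
    F[X] :=
  letI : NormalizedGCDMonoid F[X] := UniqueFactorizationMonoid.toNormalizedGCDMonoid F[X]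
  (Finset.range (δ - 1)).lcm fun j => minpoly F (β ^ (b + j))

/-- The BCH code of length `n` over `F` with designed distance `δ` and offset `b`, with respect
to the `n`-th root of unity `β`. -/
def bchCode (F : Type*) {K : Type*} [Field F] [Field K] [Algebra F K] (n : ℕ) (β : K)
    (δ b : ℕ) : Submodule F (Fin n → F) :=
  cyclicCode F n (bchGenerator F β δ b)

open Classical in
/-- The minimum Hamming distance of a linear code, i.e. the least weight of a nonzero codeword
(`0` for the zero code). -/
def minDist {F : Type*} [Field F] {n : ℕ} (C : Submodule F (Fin n → F)) : ℕ :=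
  sInf {w : ℕ | ∃ c ∈ C, c ≠ 0 ∧ hammingNorm c = w}

/-- The Euclidean dual code. -/
def dualCode {F : Type*} [Field F] {n : ℕ} (C : Submodule F (Fin n → F)) :
    Submodule F (Fin n → F) where
  carrier := {b | ∀ c ∈ C, b ⬝ᵥ c = 0}
  zero_mem' := fun c _ => zero_dotProduct c
  add_mem' := fun {x y} hx hy c hc => by rw [add_dotProduct, hx c hc, hy c hc, add_zero]
  smul_mem' := fun r x hx c hc => by rw [smul_dotProduct, hx c hc, smul_zero]

/-- Linear codes with complementary dual. -/
def IsLCD {F : Type*} [Field F] {n : ℕ} (C : Submodule F (Fin n → F)) : Prop :=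
  C ⊓ dualCode C = ⊥

end

/-! Put `N = q ^ m + 1 = λ n` and `Q = q ^ t`, so that `N = Q² q + 1`. The dimension of a cyclic
code is its length minus the number of roots of the generator, and the roots of `bchGenerator` are
the powers of `β` with exponents in the `q`-cyclotomic cosets of consecutive integers
(`finrank_bchCode_add_card`). The problem is thus to count the cosets modulo `n` that meet `1, …,
D`, where `D = δ - 1`.

Because `q ^ m ≡ -1` modulo `n`, every coset is closed under negation. This gives the LCD property,
and it adds negative exponents to the zeros `0, …, D`, so the BCH bound applies to `2 D + 1`
consecutive zeros.

For the count, multiply exponents by `λ`, so that one works modulo `N` with `X = λ i ≤ 2 Q q + 2 q -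
1`. If two such numbers `X`, `Y` lie in one coset, then up to exchanging them `q ^ s X ≡ ± Y` with
`s ≤ t` (`exists_pow_le_of_dvd_sub_mul_pow`). For `s < t` both sides are too small to wrap around
modulo `N`, so `Y = q ^ s X`. For `s = t` at most two multiples of `N` intervene, and the larger
number must lie in the explicit set `IsExceptional` unless `q` divides it. Conversely each
exceptional number not divisible by `q` has a smaller partner (`exists_smaller_of_isExceptional`).
The same analysis shows that every coset involved has the full size `2 m`.

So the number of cosets is the number of non-multiples of `q` up to `D`, which is the ceiling `ε`,
minus the exceptional ones: a window around `A`, the isolated points `A + r Q` and `A + B + a Q`,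
and everything from `κ` on (`card_filter_isLeader`). The cases of the theorem record how many
isolated points have been passed (`dimension_formula`). -/

/-! ### Cyclic codes: dimension, duals and the BCH bound. -/

section CyclicCodes

variable {F K : Type*} [Field F] [Field K] [Algebra F K]

theorem vecToPoly_apply (n : ℕ) (c : Fin n → F) :
    vecToPoly F n c = ∑ i : Fin n, monomial (i : ℕ) (c i) := by
  simp [vecToPoly]

theorem aeval_vecToPoly (n : ℕ) (c : Fin n → F) (x : K) :
    aeval x (vecToPoly F n c) = ∑ i : Fin n, algebraMap F K (c i) * x ^ (i : ℕ) := by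
  simp [vecToPoly_apply, aeval_monomial]

theorem vecToPoly_coeff {n : ℕ} {p : F[X]} (hp : p.degree < n) :
    vecToPoly F n (fun i => p.coeff i) = p := by
  rw [vecToPoly_apply, Fin.sum_univ_eq_sum_range (fun i => monomial i (p.coeff i)) n]
  by_cases h0 : p = 0
  · simp [h0]
  · exact (p.as_sum_range' n ((natDegree_lt_iff_degree_lt h0).2 hp)).symm

theorem mem_cyclicCode_iff {n : ℕ} {g : F[X]} (hg : g ∣ X ^ n - 1) (c : Fin n → F) :
    c ∈ cyclicCode F n g ↔ g ∣ vecToPoly F n c := by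
  simp only [cyclicCode, vecToQuot, Submodule.mem_comap, Submodule.restrictScalars_mem,
    LinearMap.comp_apply, AlgHom.toLinearMap_apply, Ideal.Quotient.mkₐ_eq_mk,
    Ideal.mem_span_singleton]
  constructor
  · rintro ⟨r, hr⟩
    obtain ⟨r, rfl⟩ := Ideal.Quotient.mk_surjective r
    rw [← map_mul, Ideal.Quotient.eq, Ideal.mem_span_singleton] at hr
    exact (dvd_sub_left (dvd_mul_right g r)).1 (hg.trans hr)
  · exact fun h => map_dvd _ h

/-- The code is the kernel of the surjection from `F ^ n` onto `F[X] / (g)`; rank-nullity gives the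
dimension. -/
theorem finrank_cyclicCode {n : ℕ} (hn : 0 < n) {g : F[X]} (hg : g ∣ X ^ n - 1) :
    Module.finrank F (cyclicCode F n g) + g.natDegree = n := by
  have hX : (X ^ n - 1 : F[X]) ≠ 0 := X_pow_sub_C_ne_zero hn 1
  have hg0 : g ≠ 0 := ne_zero_of_dvd_ne_zero hX hg
  have hdeg : g.natDegree ≤ n := by
    have := natDegree_le_of_dvd hg hX
    rwa [← C_1, natDegree_X_pow_sub_C] at this
  set φ : (Fin n → F) →ₗ[F] (F[X] ⧸ Ideal.span {g}) :=
    (Ideal.Quotient.mkₐ F (Ideal.span {g})).toLinearMap ∘ₗ vecToPoly F n with hφ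
  have hker : LinearMap.ker φ = cyclicCode F n g := by
    ext c
    rw [mem_cyclicCode_iff hg, LinearMap.mem_ker, hφ, LinearMap.comp_apply,
      AlgHom.toLinearMap_apply, Ideal.Quotient.mkₐ_eq_mk, Ideal.Quotient.eq_zero_iff_dvd]
  have hsurj : Function.Surjective φ := by
    intro r
    obtain ⟨p, rfl⟩ := Ideal.Quotient.mk_surjective r
    refine ⟨fun i => (p % g).coeff i, ?_⟩
    rw [hφ, LinearMap.comp_apply, vecToPoly_coeff, AlgHom.toLinearMap_apply,
      Ideal.Quotient.mkₐ_eq_mk, Ideal.Quotient.eq, Ideal.mem_span_singleton]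
    · exact (dvd_sub_comm).1 ⟨p / g, by rw [sub_eq_iff_eq_add, EuclideanDomain.div_add_mod]⟩
    · refine (EuclideanDomain.mod_lt p hg0).trans_le ?_
      rw [degree_eq_natDegree hg0]
      exact_mod_cast hdeg
  have h := LinearMap.finrank_range_add_finrank_ker φ
  rw [hker, LinearMap.range_eq_top.2 hsurj, finrank_top, finrank_quotient_span_eq_natDegree,
    Module.finrank_fin_fun] at h
  omega

/-- The coefficient vector of the reduction of `p` modulo `X ^ n - 1`. -/
noncomputable def reducedVec (n : ℕ) (p : F[X]) : Fin n → F := fun i => (p %ₘ (X ^ n - 1)).coeff i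

theorem monic_X_pow_sub_one {n : ℕ} (hn : 0 < n) : (X ^ n - 1 : F[X]).Monic := by
  rw [← C_1]; exact monic_X_pow_sub_C 1 hn.ne'

theorem degree_modByMonic_X_pow_sub_one_lt {n : ℕ} (hn : 0 < n) (p : F[X]) :
    (p %ₘ (X ^ n - 1)).degree < n := by
  have h := degree_modByMonic_lt p (monic_X_pow_sub_one (F := F) hn)
  rwa [← C_1, degree_X_pow_sub_C hn] at h

theorem vecToPoly_reducedVec {n : ℕ} (hn : 0 < n) (p : F[X]) :
    vecToPoly F n (reducedVec n p) = p %ₘ (X ^ n - 1) :=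
  vecToPoly_coeff (degree_modByMonic_X_pow_sub_one_lt hn p)

theorem reducedVec_mem_cyclicCode {n : ℕ} (hn : 0 < n) {g p : F[X]} (hg : g ∣ X ^ n - 1)
    (hp : g ∣ p) : reducedVec n p ∈ cyclicCode F n g := by
  rw [mem_cyclicCode_iff hg, vecToPoly_reducedVec hn, modByMonic_eq_sub_mul_div]
  exact dvd_sub hp (hg.mul_right _)

theorem reducedVec_add (n : ℕ) (p r : F[X]) :
    reducedVec n (p + r) = reducedVec n p + reducedVec n r := by
  ext i; simp [reducedVec, add_modByMonic]

theorem reducedVec_smul (n : ℕ) (a : F) (p : F[X]) :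
    reducedVec n (a • p) = a • reducedVec n p := by
  ext i; simp [reducedVec, smul_modByMonic]

theorem reducedVec_X_pow {n : ℕ} (hn : 0 < n) (s : ℕ) :
    reducedVec n (X ^ s : F[X]) = Pi.single ⟨s % n, Nat.mod_lt _ hn⟩ 1 := by
  have h1 : (X ^ s : F[X]) %ₘ (X ^ n - 1) = X ^ (s % n) := by
    have hd : (X ^ n - 1 : F[X]) ∣ X ^ s - X ^ (s % n) := by
      have e : (X ^ s - X ^ (s % n) : F[X]) = ((X ^ n) ^ (s / n) - 1 ^ (s / n)) * X ^ (s % n) := by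
        rw [one_pow, sub_mul, one_mul, ← pow_mul, ← pow_add, Nat.div_add_mod]
      exact e ▸ (sub_dvd_pow_sub_pow _ _ _).mul_right _
    rw [modByMonic_eq_of_dvd_sub (monic_X_pow_sub_one hn) hd,
      modByMonic_eq_self_iff (monic_X_pow_sub_one hn), ← C_1, degree_X_pow_sub_C hn, degree_X_pow]
    exact_mod_cast Nat.mod_lt _ hn
  ext i
  rw [reducedVec, h1, coeff_X_pow, Pi.single_apply]
  simp [Fin.ext_iff]

/-- Each factor `γ` rotates the sum by one place, and the term that wraps around fits because `γ ^ n
= 1`. -/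
theorem sum_rotate {n : ℕ} (hn : 0 < n) (w : ℕ → K) {γ : K} (hγ : γ ^ n = 1) (s : ℕ) :
    γ ^ s * ∑ i ∈ Finset.range n, γ ^ i * w ((i + s) % n) =
      ∑ i ∈ Finset.range n, γ ^ i * w (i % n) := by
  induction s with
  | zero => simp
  | succ s ih =>
    rw [← ih, pow_succ, mul_assoc, Finset.mul_sum]
    congr 1
    obtain ⟨k, rfl⟩ : ∃ k, n = k + 1 := ⟨n - 1, by omega⟩
    rw [Finset.sum_range_succ, Finset.sum_range_succ' (fun i => γ ^ i * w ((i + s) % (k + 1)))]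
    congr 1
    · refine Finset.sum_congr rfl fun i _ => ?_
      rw [show i + (s + 1) = i + 1 + s by ring]; ring
    · rw [← mul_assoc, ← pow_succ', hγ, show k + (s + 1) = s + (k + 1) by ring,
        Nat.add_mod_right]
      simp

/-- The inner products of `v` with all cyclic shifts of `p` form a cyclic correlation, which the
discrete Fourier transform turns into a product. By linearity `p` may be a monomial. -/
theorem sum_dotProduct_reducedVec {n : ℕ} (hn : 0 < n) (v : Fin n → F) {γ : K}
    (hγ : γ ^ n = 1) (p : F[X]) :
    ∑ i ∈ Finset.range n, γ ^ i * algebraMap F K (v ⬝ᵥ reducedVec n (X ^ i * p)) =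
      aeval γ⁻¹ p * aeval γ (vecToPoly F n v) := by
  have hγ0 : γ ≠ 0 := by
    rintro rfl
    simp [hn.ne'] at hγ
  induction p using Polynomial.induction_on' with
  | add p r hp hr =>
    simp only [mul_add, reducedVec_add, dotProduct_add, map_add, Finset.sum_add_distrib, hp, hr,
      add_mul]
  | monomial s a =>
    set w : ℕ → K := fun j => if h : j < n then algebraMap F K (v ⟨j, h⟩) else 0 with hw
    have h1 : ∀ i, γ ^ i * algebraMap F K (v ⬝ᵥ reducedVec n (X ^ i * monomial s a)) =
        algebraMap F K a * (γ ^ i * w ((i + s) % n)) := by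
      intro i
      have : (X ^ i * monomial s a : F[X]) = a • X ^ (i + s) := by
        rw [← C_mul_X_pow_eq_monomial, smul_eq_C_mul, pow_add]; ring
      rw [this, reducedVec_smul, reducedVec_X_pow hn, dotProduct_smul, dotProduct_single, hw]
      simp only [Nat.mod_lt _ hn, dif_pos, smul_eq_mul, mul_one, map_mul]
      ring
    simp only [h1]
    rw [← Finset.mul_sum, aeval_monomial, mul_assoc]
    congr 1
    rw [inv_pow, eq_inv_mul_iff_mul_eq₀ (pow_ne_zero _ hγ0), sum_rotate hn w hγ, aeval_vecToPoly,
      ← Fin.sum_univ_eq_sum_range (fun i => γ ^ i * w (i % n))]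
    refine Finset.sum_congr rfl fun i _ => ?_
    simp only [Nat.mod_eq_of_lt i.2, hw, i.2, dif_pos]
    ring

/-- A word orthogonal to a cyclic code vanishes at the inverses of the nonzeros of its
generator. -/
theorem aeval_eq_zero_of_mem_dualCode {n : ℕ} (hn : 0 < n) {g : F[X]} (hg : g ∣ X ^ n - 1)
    {v : Fin n → F} (hv : v ∈ dualCode (cyclicCode F n g)) {γ : K} (hγ : γ ^ n = 1)
    (hgγ : aeval γ⁻¹ g ≠ 0) : aeval γ (vecToPoly F n v) = 0 := by
  have h := sum_dotProduct_reducedVec hn v hγ g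
  -- Every shift `X ^ i * g` reduces to a codeword, so each inner product vanishes.
  rw [Finset.sum_eq_zero] at h
  · exact (mul_eq_zero.1 h.symm).resolve_left hgγ
  · intro i _
    rw [hv _ (reducedVec_mem_cyclicCode hn hg (dvd_mul_left _ _))]
    simp

theorem eq_zero_of_aeval_vecToPoly {n : ℕ} {β : K} (hβ : IsPrimitiveRoot β n)
    {v : Fin n → F} (hv : ∀ l, aeval (β ^ l) (vecToPoly F n v) = 0) : v = 0 := by
  have h : (fun i => algebraMap F K (v i)) = 0 := by
    refine Matrix.eq_zero_of_forall_pow_sum_mul_pow_eq_zero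
      (f := fun i : Fin n => β ^ (i : ℕ)) ?_ ?_
    · intro i j hij
      exact Fin.ext (hβ.pow_inj i.2 j.2 hij)
    · intro i
      have := hv i
      rw [aeval_vecToPoly] at this
      simpa only [← pow_mul, mul_comm (i : ℕ)] using this
  ext i
  have := congrFun h i
  simpa using this

/-- The BCH bound: a word of weight at most `w` that vanishes at `a, a * β, …, a * β ^ (w - 1)`
is zero. -/
theorem eq_zero_of_hammingNorm_le {n : ℕ} [DecidableEq F] {β a : K} (hβ : IsPrimitiveRoot β n)
    (ha : a ≠ 0) {c : Fin n → F} {w : ℕ} (hw : hammingNorm c ≤ w)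
    (hc : ∀ j < w, aeval (a * β ^ j) (vecToPoly F n c) = 0) : c = 0 := by
  classical
  set S : Finset (Fin n) := Finset.univ.filter fun i => c i ≠ 0 with hS
  have hcard : S.card ≤ w := hw
  set e := S.equivFin.symm
  -- On the support of `c`, the first `S.card ≤ w` vanishing conditions form a square Vandermonde
  -- system with distinct nodes `β ^ i` and unknowns `c i * a ^ i`.
  have h : (fun k => algebraMap F K (c (e k)) * a ^ ((e k : Fin n) : ℕ)) = 0 := by
    refine Matrix.eq_zero_of_forall_pow_sum_mul_pow_eq_zero
      (f := fun k => β ^ ((e k : Fin n) : ℕ)) ?_ ?_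
    · intro i j hij
      exact e.injective (Subtype.ext (Fin.ext (hβ.pow_inj (e i : Fin n).2 (e j : Fin n).2 hij)))
    · intro j
      have h1 := hc j (j.2.trans_le hcard)
      rw [aeval_vecToPoly] at h1
      rw [Equiv.sum_comp e (fun i : S => algebraMap F K (c i) * a ^ ((i : Fin n) : ℕ) *
        (β ^ ((i : Fin n) : ℕ)) ^ (j : ℕ)),
        Finset.sum_coe_sort S (fun i => algebraMap F K (c i) * a ^ (i : ℕ) *
        (β ^ (i : ℕ)) ^ (j : ℕ)), ← h1]
      generalize (j : ℕ) = j
      rw [hS, Finset.sum_filter_of_ne]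
      · refine Finset.sum_congr rfl fun i _ => ?_
        rw [mul_pow, ← pow_mul, ← pow_mul, mul_comm (i : ℕ), mul_assoc]
      · intro i _ hi h0
        simp [h0] at hi
  ext i
  by_contra hi
  have hi' : i ∈ S := by simpa [hS] using hi
  have := congrFun h (e.symm ⟨i, hi'⟩)
  simp only [Equiv.apply_symm_apply, Pi.zero_apply, mul_eq_zero, pow_eq_zero_iff', ha, false_and,
    or_false, map_eq_zero] at this
  exact hi this

/-- The zero code has to be excluded because `minDist` assigns it the value `0`. -/
theorem le_minDist {n w : ℕ} {C : Submodule F (Fin n → F)} (hC : C ≠ ⊥)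
    (h : ∀ [DecidableEq F], ∀ c ∈ C, hammingNorm c < w → c = 0) : w ≤ minDist C := by
  classical
  obtain ⟨c, hc, hc0⟩ := C.ne_bot_iff.1 hC
  refine le_csInf ⟨_, c, hc, hc0, rfl⟩ ?_
  rintro _ ⟨c, hc, hc0, rfl⟩
  by_contra hlt
  refine hc0 (h c hc ?_)
  convert not_le.1 hlt

end CyclicCodes

/-! ### BCH codes: zeros, cosets, LCD property and distance bounds. -/

section BCHCodes

variable {F K : Type*} [Field F] [Field K] [Algebra F K]

theorem bchGenerator_dvd_iff {β : K} {δ b : ℕ} {p : F[X]} :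
    bchGenerator F β δ b ∣ p ↔ ∀ j < δ - 1, minpoly F (β ^ (b + j)) ∣ p := by
  classical
  unfold bchGenerator
  simp [Finset.lcm_dvd_iff]

theorem IsPrimitiveRoot.isIntegral_pow_of_pos {n : ℕ} (hn : 0 < n) {β : K}
    (hβ : IsPrimitiveRoot β n) (i : ℕ) : IsIntegral F (β ^ i) :=
  (hβ.isIntegral hn).tower_top.pow i

theorem bchGenerator_dvd_X_pow_sub_one {n : ℕ} {β : K} (hβ : IsPrimitiveRoot β n) (δ b : ℕ) :
    bchGenerator F β δ b ∣ X ^ n - 1 := by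
  rw [bchGenerator_dvd_iff]
  intro j _
  apply minpoly.dvd
  simp [← pow_mul, mul_comm _ n, pow_mul β n, hβ.pow_eq_one]

theorem aeval_bchGenerator_eq_zero_iff {β γ : K} {δ b : ℕ} :
    aeval γ (bchGenerator F β δ b) = 0 ↔
      ∃ j < δ - 1, aeval γ (minpoly F (β ^ (b + j))) = 0 := by
  constructor
  · intro h
    have hd : bchGenerator F β δ b ∣ ∏ j ∈ Finset.range (δ - 1), minpoly F (β ^ (b + j)) :=
      bchGenerator_dvd_iff.2 fun j hj => Finset.dvd_prod_of_mem _ (Finset.mem_range.2 hj)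
    have h0 := aeval_eq_zero_of_dvd_aeval_eq_zero hd h
    rw [map_prod, Finset.prod_eq_zero_iff] at h0
    obtain ⟨j, hj, h0⟩ := h0
    exact ⟨j, Finset.mem_range.1 hj, h0⟩
  · rintro ⟨j, hj, h⟩
    exact aeval_eq_zero_of_dvd_aeval_eq_zero (bchGenerator_dvd_iff.1 dvd_rfl j hj) h

theorem mem_bchCode_iff {n : ℕ} {β : K} (hβ : IsPrimitiveRoot β n) {δ b : ℕ} {c : Fin n → F} :
    c ∈ bchCode F n β δ b ↔ ∀ j < δ - 1, aeval (β ^ (b + j)) (vecToPoly F n c) = 0 := by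
  rw [bchCode, mem_cyclicCode_iff (bchGenerator_dvd_X_pow_sub_one hβ δ b), bchGenerator_dvd_iff]
  simp only [minpoly.dvd_iff]

theorem inv_pow_eq_pow_card_pow {n q m : ℕ} (hm : n ∣ q ^ m + 1) {β : K}
    (hβ : IsPrimitiveRoot β n) (l : ℕ) :
    (β ^ l)⁻¹ = (β ^ l) ^ q ^ m := by
  apply inv_eq_of_mul_eq_one_right
  rw [← pow_succ', ← pow_mul, mul_comm, pow_mul, (hβ.pow_eq_one_iff_dvd _).2 hm, one_pow]

theorem le_minDist_bchCode {n δ : ℕ} (hn : 0 < n) {β : K} (hβ : IsPrimitiveRoot β n) (b : ℕ)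
    (h : bchCode F n β δ b ≠ ⊥) : δ ≤ minDist (bchCode F n β δ b) := by
  refine le_minDist h fun c hc hw => ?_
  rw [mem_bchCode_iff hβ] at hc
  refine eq_zero_of_hammingNorm_le hβ (pow_ne_zero b (hβ.ne_zero hn.ne')) (w := δ - 1)
    (by omega) fun j hj => ?_
  rw [← pow_add]
  exact hc j hj

variable [Fintype F]

theorem aeval_pow_card_pow (x : K) (p : F[X]) (e : ℕ) :
    aeval (x ^ Fintype.card F ^ e) p = aeval x p ^ Fintype.card F ^ e := by
  induction e with
  | zero => simp
  | succ e ih =>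
    rw [pow_succ, pow_mul, pow_mul, ← ih]
    have := aeval_algHom_apply (FiniteField.frobeniusAlgHom F K) (x ^ Fintype.card F ^ e) p
    simpa using this

/-- Roots of one minimal polynomial are Galois conjugate, and the Galois group of a finite field is
generated by Frobenius. Since `K` need not be finite, the argument is made in `F(β)`. -/
theorem aeval_minpoly_eq_zero_iff {n : ℕ} (hn : 0 < n) {β : K} (hβ : IsPrimitiveRoot β n)
    (i j : ℕ) :
    aeval (β ^ i) (minpoly F (β ^ j)) = 0 ↔ ∃ e, i ≡ j * Fintype.card F ^ e [MOD n] := by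
  have key : aeval (β ^ i) (minpoly F (β ^ j)) = 0 ↔
      ∃ e, β ^ i = (β ^ j) ^ Fintype.card F ^ e := by
    constructor
    · intro h
      have hint : IsIntegral F β := by simpa using hβ.isIntegral_pow_of_pos (F := F) hn 1
      have : FiniteDimensional F (IntermediateField.adjoin F {β}) :=
        IntermediateField.adjoin.finiteDimensional hint
      have : Finite (IntermediateField.adjoin F {β}) := Module.finite_of_finite F
      set L := IntermediateField.adjoin F {β}
      let β' : L := IntermediateField.AdjoinSimple.gen F β
      have hβ' : algebraMap L K β' = β := IntermediateField.AdjoinSimple.algebraMap_gen F β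
      have hconj : IsConjRoot F (β' ^ j) (β' ^ i) := by
        rw [isConjRoot_iff_aeval_eq_zero (Algebra.IsIntegral.isIntegral _)]
        apply (algebraMap L K).injective
        rw [← aeval_algebraMap_apply, map_zero, map_pow, hβ',
          ← minpoly.algebraMap_eq (algebraMap L K).injective, map_pow, hβ', h]
      obtain ⟨σ, hσ⟩ := hconj.symm.exists_algEquiv
      obtain ⟨e, he⟩ := (FiniteField.bijective_frobeniusAlgEquivOfAlgebraic_pow F L).2 σ
      refine ⟨e, ?_⟩
      have h2 := congrArg (algebraMap L K) hσ
      rw [← he] at h2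
      simp only [AlgEquiv.coe_pow, FiniteField.coe_frobeniusAlgEquivOfAlgebraic_iterate] at h2
      simpa only [map_pow, hβ'] using h2.symm
    · rintro ⟨e, he⟩
      rw [he, aeval_pow_card_pow, minpoly.aeval, zero_pow]
      exact pow_ne_zero _ Fintype.card_ne_zero
  rw [key]
  refine exists_congr fun e => ?_
  rw [← pow_mul, (isOfFinOrder_iff_pow_eq_one.2 ⟨n, hn, hβ.pow_eq_one⟩).pow_eq_pow_iff_modEq,
    ← hβ.eq_orderOf]

open Classical in
/-- The union of the `q`-cyclotomic cosets modulo `n` of the elements of `s`. -/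
noncomputable def cosetUnion (n q : ℕ) (s : Set ℕ) : Finset ℕ :=
  (Finset.range n).filter fun x => ∃ i ∈ s, ∃ e, x ≡ i * q ^ e [MOD n]

theorem mem_cosetUnion {n q : ℕ} {s : Set ℕ} {x : ℕ} :
    x ∈ cosetUnion n q s ↔ x < n ∧ ∃ i ∈ s, ∃ e, x ≡ i * q ^ e [MOD n] := by
  simp [cosetUnion]

theorem finrank_bchCode_add_card {n : ℕ} (hn : 0 < n) (hnF : (n : F) ≠ 0) {β : K}
    (hβ : IsPrimitiveRoot β n) (δ b : ℕ) :
    Module.finrank F (bchCode F n β δ b) +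
      (cosetUnion n (Fintype.card F) (Set.Ico b (b + (δ - 1)))).card = n := by
  classical
  have hdvd := bchGenerator_dvd_X_pow_sub_one (F := F) hβ δ b
  rw [bchCode]
  convert finrank_cyclicCode hn hdvd using 2
  set g := bchGenerator F β δ b with hg
  have hX : (X ^ n - 1 : K[X]) ≠ 0 := X_pow_sub_C_ne_zero hn 1
  have hg0 : g ≠ 0 := ne_zero_of_dvd_ne_zero (X_pow_sub_C_ne_zero hn 1) hdvd
  have hsep : g.Separable := (X_pow_sub_one_separable_iff.2 hnF).of_dvd hdvd
  have hsplit : (g.map (algebraMap F K)).Splits := by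
    refine Splits.of_dvd (X_pow_sub_one_splits hβ) hX ?_
    simpa using map_dvd (mapRingHom (algebraMap F K)) hdvd
  -- The generator is separable, since `n ≠ 0` in `F`, and it splits over `K`; its degree is
  -- therefore its number of roots.
  rw [← card_rootSet_eq_natDegree hsep hsplit]
  have hset : g.rootSet K =
      ((cosetUnion n (Fintype.card F) (Set.Ico b (b + (δ - 1)))).image (β ^ ·) : Finset K) := by
    have hiff : ∀ x, aeval (β ^ x) g = 0 ↔
        ∃ i ∈ Set.Ico b (b + (δ - 1)), ∃ e, x ≡ i * Fintype.card F ^ e [MOD n] := by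
      intro x
      rw [hg, aeval_bchGenerator_eq_zero_iff]
      simp only [aeval_minpoly_eq_zero_iff hn hβ]
      constructor
      · rintro ⟨j, hj, h⟩
        exact ⟨b + j, ⟨by omega, by omega⟩, h⟩
      · rintro ⟨i, ⟨hi1, hi2⟩, h⟩
        exact ⟨i - b, by omega, by rwa [Nat.add_sub_cancel' hi1]⟩
    ext y
    rw [mem_rootSet_of_ne hg0, Finset.mem_coe, Finset.mem_image]
    constructor
    · intro hy
      have hyn : y ^ n = 1 := by
        have := aeval_eq_zero_of_dvd_aeval_eq_zero hdvd hy
        simpa [sub_eq_zero] using this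
      have : NeZero n := ⟨hn.ne'⟩
      obtain ⟨x, hx, rfl⟩ := hβ.eq_pow_of_pow_eq_one hyn
      exact ⟨x, mem_cosetUnion.2 ⟨hx, (hiff x).1 hy⟩, rfl⟩
    · rintro ⟨x, hx, rfl⟩
      exact (hiff x).2 (mem_cosetUnion.1 hx).2
  rw [← Nat.card_eq_fintype_card (α := g.rootSet K), Nat.card_coe_set_eq, hset, Set.ncard_coe_finset,
    Finset.card_image_of_injOn]
  intro x hx y hy hxy
  exact hβ.pow_inj (mem_cosetUnion.1 hx).1 (mem_cosetUnion.1 hy).1 hxy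

/-- Every cyclic code whose length divides some `q ^ m + 1` is LCD. -/
theorem isLCD_bchCode {n m : ℕ} (hn : 0 < n) (hm : n ∣ Fintype.card F ^ m + 1) {β : K}
    (hβ : IsPrimitiveRoot β n) (δ b : ℕ) : IsLCD (bchCode F n β δ b) := by
  rw [IsLCD, eq_bot_iff]
  rintro v ⟨hv, hv'⟩
  have hdvd := bchGenerator_dvd_X_pow_sub_one (F := F) hβ δ b
  refine eq_zero_of_aeval_vecToPoly hβ fun l => ?_
  by_cases hl : aeval (β ^ l) (bchGenerator F β δ b) = 0
  · exact aeval_eq_zero_of_dvd_aeval_eq_zero ((mem_cyclicCode_iff hdvd v).1 hv) hl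
  -- At a nonzero of the generator, membership in the dual makes `v` vanish at the inverse point.
  -- That point is a Frobenius conjugate of `β ^ l`, so `v` vanishes at `β ^ l` too.
  · have h := aeval_eq_zero_of_mem_dualCode hn hdvd hv' (γ := (β ^ l)⁻¹)
      (by rw [inv_pow, ← pow_mul, mul_comm, pow_mul, hβ.pow_eq_one, one_pow, inv_one])
      (by rwa [inv_inv])
    rw [inv_pow_eq_pow_card_pow hm hβ, aeval_pow_card_pow] at h
    exact eq_zero_of_pow_eq_zero h

/-- If `-1` is a power of `q` modulo `n`, the zeros `β ^ (-(δ - 1)), …, β ^ (δ - 1)` double the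
designed distance. -/
theorem two_mul_le_minDist_bchCode {n m δ : ℕ} (hn : 0 < n) (hm : n ∣ Fintype.card F ^ m + 1)
    {β : K} (hβ : IsPrimitiveRoot β n) (h : bchCode F n β (δ + 1) 0 ≠ ⊥) :
    2 * δ ≤ minDist (bchCode F n β (δ + 1) 0) := by
  refine le_minDist h fun c hc hw => ?_
  simp only [mem_bchCode_iff hβ, Nat.add_sub_cancel, zero_add] at hc
  have hβ0 : β ≠ 0 := hβ.ne_zero hn.ne'
  refine eq_zero_of_hammingNorm_le hβ (inv_ne_zero (pow_ne_zero (δ - 1) hβ0)) (w := 2 * δ - 1)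
    (by omega) fun j hj => ?_
  rcases le_total (δ - 1) j with hjd | hjd
  · obtain ⟨i, rfl⟩ := Nat.exists_eq_add_of_le hjd
    rw [pow_add, inv_mul_cancel_left₀ (pow_ne_zero _ hβ0)]
    exact hc i (by omega)
  · obtain ⟨i, hi⟩ := Nat.exists_eq_add_of_le hjd
    rw [hi, pow_add, mul_inv, mul_comm, mul_inv_cancel_left₀ (pow_ne_zero _ hβ0),
      inv_pow_eq_pow_card_pow hm hβ, aeval_pow_card_pow, hc i (by omega), zero_pow]
    exact pow_ne_zero _ Fintype.card_ne_zero

end BCHCodes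

/-! ### Which integers are least in their coset: arithmetic modulo `q ^ m + 1`. -/

section CosetLeaders

/-- The multiples `X = λ i` prime to `q`, in the range that matters, for which `i` is not the least
positive element of its coset, where `Q = q ^ t`. -/
def IsExceptional (q Q X : ℤ) : Prop :=
  (Q * q - q < X ∧ X < Q * q + q) ∨ 2 * (Q * q) - 2 * q < X ∨
    ∃ w, q < w ∧ w < 2 * q ∧ (X = Q * w - 1 ∨ X = Q * w + 1)

/-- With `P ≤ Q / q`, the product `P U` is at most about `2 Q²`, less than the modulus since `q ≥
3`. So the difference must be zero, and positivity excludes `σ = -1`. -/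
theorem eq_mul_of_dvd_of_mul_le {q Q P U V σ : ℤ} (hq : 3 ≤ q) (hQ : 9 * q ≤ Q) (hP : 1 ≤ P)
    (hPQ : P * q ≤ Q) (hU : 1 ≤ U) (hU' : U ≤ 2 * (Q * q) + 2 * q - 1) (hV : 1 ≤ V)
    (hV' : V ≤ 2 * (Q * q) + 2 * q - 1) (hσ : σ = 1 ∨ σ = -1)
    (h : Q ^ 2 * q + 1 ∣ P * U - σ * V) : σ = 1 ∧ V = P * U := by
  have hPU : 1 ≤ P * U := by nlinarith
  have hlt : P * U + V < Q ^ 2 * q + 1 := by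
    have h1 : q * (P * U) ≤ Q * (2 * (Q * q) + 2 * q - 1) := by
      calc q * (P * U) = (P * q) * U := by ring
        _ ≤ Q * U := by gcongr
        _ ≤ _ := by gcongr; linarith
    have h2 : q * V ≤ q * (2 * (Q * q) + 2 * q - 1) := by gcongr
    have h3 : 0 < Q * q := by nlinarith
    have h4 : 0 ≤ Q ^ 2 * q * (q - 3) := by
      have : 0 ≤ Q ^ 2 * q := by positivity
      exact mul_nonneg this (by linarith)
    have h5 : 0 ≤ Q * q * (Q - 9 * q) := mul_nonneg h3.le (by linarith)
    have h6 : 0 ≤ Q * q * (q - 3) := mul_nonneg h3.le (by linarith)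
    have h7 : 0 ≤ q * (Q - 9 * q) := mul_nonneg (by linarith) (by linarith)
    have h8 : q * (P * U + V) < q * (Q ^ 2 * q + 1) := by nlinarith
    exact lt_of_mul_lt_mul_left h8 (by linarith)
  have h0 := Int.eq_zero_of_abs_lt_dvd h (by rcases hσ with rfl | rfl <;> rw [abs_lt] <;>
    constructor <;> linarith)
  rcases hσ with rfl | rfl
  · exact ⟨rfl, by linarith⟩
  · linarith

/-- Here `Q U` can reach about twice the modulus, so the quotient `c` is `0`, `1` or `2`. For `c ≠
0` the shift `U = c Q q + w` absorbs the multiple: `Q U - c (Q² q + 1) = Q w - c`. -/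
theorem exists_shift_of_dvd {q Q U V σ : ℤ} (hq : 3 ≤ q) (hQ : 9 * q ≤ Q)
    (hU : 1 ≤ U) (hU' : U ≤ 2 * (Q * q) + 2 * q - 1) (hV : 1 ≤ V)
    (hV' : V ≤ 2 * (Q * q) + 2 * q - 1) (hσ : σ = 1 ∨ σ = -1)
    (h : Q ^ 2 * q + 1 ∣ Q * U - σ * V) :
    (σ = 1 ∧ V = Q * U) ∨ ∃ c w : ℤ, (c = 1 ∨ c = 2) ∧ U = c * (Q * q) + w ∧
      (V = Q * w - c ∨ V = c - Q * w) := by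
  obtain ⟨c, hc⟩ := h
  have hQU : Q * U ≤ Q * (2 * (Q * q) + 2 * q - 1) := by gcongr; linarith
  have hQU0 : 1 ≤ Q * U := by nlinarith
  have h3 : 0 < Q * q := by nlinarith
  have h5 : 0 ≤ Q * q * (Q - 9 * q) := mul_nonneg h3.le (by linarith)
  have h6 : 0 ≤ Q * q * (q - 3) := mul_nonneg h3.le (by linarith)
  have hN : 0 < Q ^ 2 * q + 1 := by positivity
  have hc3 : c < 3 := by
    have : (Q ^ 2 * q + 1) * c < (Q ^ 2 * q + 1) * 3 := by
      rw [← hc]; rcases hσ with rfl | rfl <;> nlinarith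
    exact lt_of_mul_lt_mul_left this hN.le
  have hc0 : -1 < c := by
    have : (Q ^ 2 * q + 1) * (-1) < (Q ^ 2 * q + 1) * c := by
      rw [← hc]; rcases hσ with rfl | rfl <;> nlinarith
    exact lt_of_mul_lt_mul_left this hN.le
  by_cases hcz : c = 0
  · subst hcz
    rcases hσ with rfl | rfl
    · exact Or.inl ⟨rfl, by linarith⟩
    · linarith
  · refine Or.inr ⟨c, U - c * (Q * q), by omega, by ring, ?_⟩
    rcases hσ with rfl | rfl
    · left; linarith
    · right; linarith

/-- Since `U` is near `c Q q` and `V` near `Q |w|`, comparing `|w|` with `c q` decides which is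
larger. If `U` is larger, it lies in a window around `c Q q`, or `w = q` and `U = q (Q + 1)`. If `V`
is larger, it is `Q |w| ∓ 1`, or it lies in a window when `|w|` is `q` or `2 q`. -/
theorem isExceptional_max_of_shift {q Q U V c w : ℤ} (hq : 3 ≤ q) (hQ : 9 * q ≤ Q)
    (hU' : U ≤ 2 * (Q * q) + 2 * q - 1) (hV : 1 ≤ V)
    (hV' : V ≤ 2 * (Q * q) + 2 * q - 1) (hc : c = 1 ∨ c = 2) (hUw : U = c * (Q * q) + w)
    (hVw : V = Q * w - c ∨ V = c - Q * w) :
    (U < V ∧ (q ∣ V ∨ IsExceptional q Q V)) ∨ (V < U ∧ (q ∣ U ∨ IsExceptional q Q U)) := by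
  have hQ0 : 0 < Q := by linarith
  have h3 : 0 < Q * q := by nlinarith
  have hmono : ∀ a b : ℤ, a ≤ b → Q * a ≤ Q * b := fun a b h => by gcongr
  rcases hVw with hVw | hVw
  · have hw0 : 1 ≤ w := by
      by_contra hcon
      have := hmono w 0 (by linarith)
      rcases hc with rfl | rfl <;> linarith
    have hw1 : w ≤ 2 * q := by
      by_contra hcon
      have := hmono (2 * q + 1) w (by linarith)
      rcases hc with rfl | rfl <;> nlinarith
    rcases hc with rfl | rfl
    · rcases lt_trichotomy w q with hwq | rfl | hwq
      · have := hmono w (q - 1) (by linarith)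
        exact Or.inr ⟨by linarith, Or.inr (Or.inl ⟨by linarith, by linarith⟩)⟩
      · exact Or.inr ⟨by linarith, Or.inl ⟨Q + 1, by rw [hUw]; ring⟩⟩
      · have := hmono (q + 1) w (by linarith)
        refine Or.inl ⟨by linarith, Or.inr ?_⟩
        rcases hw1.lt_or_eq with h | rfl
        · exact Or.inr (Or.inr ⟨w, hwq, h, Or.inl hVw⟩)
        · exact Or.inr (Or.inl (by linarith))
    · have := hmono w (2 * q - 1) (by linarith)
      exact Or.inr ⟨by linarith, Or.inr (Or.inr (Or.inl (by linarith)))⟩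
  · obtain ⟨v, rfl⟩ : ∃ v, w = -v := ⟨-w, by ring⟩
    rw [mul_neg, sub_neg_eq_add] at hVw
    have hv0 : 0 ≤ v := by
      by_contra hcon
      have := hmono v (-1) (by linarith)
      rcases hc with rfl | rfl <;> linarith
    have hv1 : v ≤ 2 * q := by
      by_contra hcon
      have := hmono (2 * q + 1) v (by linarith)
      rcases hc with rfl | rfl <;> nlinarith
    rcases hc with rfl | rfl
    · rcases lt_trichotomy v q with hvq | rfl | hvq
      · have := hmono v (q - 1) (by linarith)
        exact Or.inr ⟨by linarith, Or.inr (Or.inl ⟨by linarith, by linarith⟩)⟩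
      · exact Or.inl ⟨by linarith, Or.inr (Or.inl ⟨by linarith, by linarith⟩)⟩
      · have := hmono (q + 1) v (by linarith)
        refine Or.inl ⟨by linarith, Or.inr ?_⟩
        rcases hv1.lt_or_eq with h | rfl
        · exact Or.inr (Or.inr ⟨v, hvq, h, Or.inr (by linarith)⟩)
        · exact Or.inr (Or.inl (by linarith))
    · rcases hv1.lt_or_eq with h | rfl
      · have := hmono v (2 * q - 1) (by linarith)
        exact Or.inr ⟨by linarith, Or.inr (Or.inr (Or.inl (by linarith)))⟩
      · exact Or.inl ⟨by linarith, Or.inr (Or.inr (Or.inl (by linarith)))⟩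

/-- The partner is explicit. In the windows it is `± Q X` reduced modulo `N = Q² q + 1`; for `X = Q
w ∓ 1` it is `Q q ± w`, because `Q (Q q ± w) = N ± X`. -/
theorem exists_smaller_of_isExceptional {q Q l X : ℤ} (hq : 3 ≤ q) (hQ : 9 * q ≤ Q)
    (hlQ : l ∣ Q + 1) (hlN : l ∣ Q ^ 2 * q + 1) (hX' : X ≤ 2 * (Q * q) + 2 * q - 1)
    (hlX : l ∣ X) (hqX : ¬ q ∣ X) (h : IsExceptional q Q X) :
    ∃ Y, 1 ≤ Y ∧ Y < X ∧ l ∣ Y ∧ ∃ σ : ℤ, (σ = 1 ∨ σ = -1) ∧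
      (Q ^ 2 * q + 1 ∣ Q * X - σ * Y ∨ Q ^ 2 * q + 1 ∣ Q * Y - σ * X) := by
  have hQ0 : 0 < Q := by linarith
  have h3 : 0 < Q * q := by nlinarith
  have hmono : ∀ a b : ℤ, a ≤ b → Q * a ≤ Q * b := fun a b h => by gcongr
  -- `Q ≡ -1` modulo `l`, so `Q` is invertible there.
  have hback : ∀ Y, l ∣ Q * Y → l ∣ Y := fun Y hY => by
    have := dvd_sub (hlQ.mul_right Y) hY
    rwa [show (Q + 1) * Y - Q * Y = Y by ring] at this
  have hpos : ∀ c w, X = c * (Q * q) + w → w ≠ 0 := by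
    rintro c w hw rfl
    exact hqX ⟨c * Q, by rw [hw]; ring⟩
  have hscale : ∀ c w, X = c * (Q * q) + w → Q * X = c * (Q ^ 2 * q + 1) + (Q * w - c) := by
    rintro c w rfl; ring
  rcases h with ⟨h1, h2⟩ | h | ⟨w, hw1, hw2, hX | hX⟩
  · obtain ⟨w, hw⟩ : ∃ w, X = 1 * (Q * q) + w := ⟨X - Q * q, by ring⟩
    have hs := hscale 1 w hw
    rcases lt_or_gt_of_ne (hpos 1 w hw) with hw0 | hw0
    · have i1 := hmono (1 - q) w (by linarith)
      have i2 := hmono w (-1) (by linarith)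
      refine ⟨1 - Q * w, by linarith, by linarith, ?_, -1, Or.inr rfl, Or.inl ⟨1, by linarith⟩⟩
      rw [show 1 - Q * w = Q ^ 2 * q + 1 - Q * X by linarith]
      exact dvd_sub hlN (hlX.mul_left _)
    · have i1 := hmono w (q - 1) (by linarith)
      have i2 := hmono 1 w (by linarith)
      refine ⟨Q * w - 1, by linarith, by linarith, ?_, 1, Or.inl rfl, Or.inl ⟨1, by linarith⟩⟩
      rw [show Q * w - 1 = Q * X - (Q ^ 2 * q + 1) by linarith]
      exact dvd_sub (hlX.mul_left _) hlN
  · obtain ⟨w, hw⟩ : ∃ w, X = 2 * (Q * q) + w := ⟨X - 2 * (Q * q), by ring⟩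
    have hs := hscale 2 w hw
    rcases lt_or_gt_of_ne (hpos 2 w hw) with hw0 | hw0
    · have i1 := hmono (1 - 2 * q) w (by linarith)
      have i2 := hmono w (-1) (by linarith)
      refine ⟨2 - Q * w, by linarith, by linarith, ?_, -1, Or.inr rfl, Or.inl ⟨2, by linarith⟩⟩
      rw [show 2 - Q * w = (Q ^ 2 * q + 1) * 2 - Q * X by linarith]
      exact dvd_sub (hlN.mul_right _) (hlX.mul_left _)
    · have i1 := hmono w (2 * q - 1) (by linarith)
      have i2 := hmono 1 w (by linarith)
      refine ⟨Q * w - 2, by linarith, by linarith, ?_, 1, Or.inl rfl, Or.inl ⟨2, by linarith⟩⟩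
      rw [show Q * w - 2 = Q * X - (Q ^ 2 * q + 1) * 2 by linarith]
      exact dvd_sub (hlX.mul_left _) (hlN.mul_right _)
  · have i1 := hmono (q + 1) w (by linarith)
    have e : Q * (Q * q + w) = Q ^ 2 * q + 1 + X := by rw [hX]; ring
    refine ⟨Q * q + w, by linarith, by linarith, hback _ ?_, 1, Or.inl rfl,
      Or.inr ⟨1, by linarith⟩⟩
    rw [e]; exact dvd_add hlN hlX
  · have i1 := hmono (q + 1) w (by linarith)
    have e : Q * (Q * q - w) = Q ^ 2 * q + 1 - X := by rw [hX]; ring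
    refine ⟨Q * q - w, by nlinarith, by linarith, hback _ ?_, -1, Or.inr rfl,
      Or.inr ⟨1, by linarith⟩⟩
    rw [e]; exact dvd_sub hlN hlX

/-- Normal form of a congruence `X ≡ Y q ^ e` modulo `q ^ (2 t + 1) + 1`: up to a sign, one of the
two sides is multiplied by a power of `q` with exponent at most `t`. -/
theorem exists_pow_le_of_dvd_sub_mul_pow {q X Y : ℤ} {t e : ℕ}
    (h : q ^ (2 * t + 1) + 1 ∣ X - Y * q ^ e) :
    ∃ s ≤ t, ∃ σ : ℤ, (σ = 1 ∨ σ = -1) ∧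
      (q ^ (2 * t + 1) + 1 ∣ q ^ s * X - σ * Y ∨ q ^ (2 * t + 1) + 1 ∣ q ^ s * Y - σ * X) ∧
      (s = 0 → σ = 1 → 2 * (2 * t + 1) ∣ e) := by
  set m := 2 * t + 1 with hm
  set N := q ^ m + 1 with hN
  obtain ⟨k, r, hr, rfl⟩ : ∃ k r, r < m ∧ e = m * k + r :=
    ⟨e / m, e % m, Nat.mod_lt _ (by omega), (Nat.div_add_mod e m).symm⟩
  -- As `q ^ m ≡ -1`, the exponent `e = m k + r` contributes `(-1) ^ k * q ^ r`. If `r > t`,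
  -- multiplying by `q ^ (m - r)` moves a power with exponent at most `t` to the other side.
  have hk : N ∣ (q ^ m) ^ k - (-1) ^ k := by
    have := sub_dvd_pow_sub_pow (q ^ m) (-1) k
    rwa [sub_neg_eq_add] at this
  have h1 : N ∣ X - (-1) ^ k * (q ^ r * Y) := by
    have := dvd_add h (hk.mul_right (q ^ r * Y))
    rwa [pow_add, pow_mul, show X - Y * ((q ^ m) ^ k * q ^ r) +
      ((q ^ m) ^ k - (-1) ^ k) * (q ^ r * Y) = X - (-1) ^ k * (q ^ r * Y) by ring] at this
  have hsq : ((-1 : ℤ) ^ k) * (-1) ^ k = 1 := by rw [← mul_pow]; simp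
  rcases le_or_gt r t with hrt | hrt
  · refine ⟨r, hrt, (-1) ^ k, neg_one_pow_eq_or ℤ k, Or.inr ?_, ?_⟩
    · have := h1.mul_left (-(-1) ^ k)
      rwa [show -(-1) ^ k * (X - (-1) ^ k * (q ^ r * Y)) =
        ((-1) ^ k * (-1) ^ k) * (q ^ r * Y) - (-1) ^ k * X by ring, hsq, one_mul] at this
    · rintro rfl hk1
      have : Even k := by
        by_contra hodd
        rw [Nat.not_even_iff_odd] at hodd
        rw [hodd.neg_one_pow] at hk1
        omega
      obtain ⟨j, rfl⟩ := this
      exact ⟨j, by ring⟩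
  · refine ⟨m - r, by omega, -(-1) ^ k, ?_, Or.inl ?_, by omega⟩
    · rcases neg_one_pow_eq_or ℤ k with h | h <;> rw [h] <;> simp
    · have hp : q ^ (m - r) * q ^ r = q ^ m := by rw [← pow_add, Nat.sub_add_cancel hr.le]
      have := dvd_add (h1.mul_left (q ^ (m - r))) (Dvd.intro ((-1) ^ k * Y) (rfl : N * _ = _))
      rwa [show q ^ (m - r) * (X - (-1) ^ k * (q ^ r * Y)) + N * ((-1) ^ k * Y) =
        q ^ (m - r) * X - (-1) ^ k * (q ^ (m - r) * q ^ r) * Y + N * ((-1) ^ k * Y) by ring, hp,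
        show q ^ (m - r) * X - (-1) ^ k * q ^ m * Y + N * ((-1) ^ k * Y) =
        q ^ (m - r) * X - -(-1) ^ k * Y by rw [hN]; ring] at this

theorem nine_mul_le_pow {q : ℤ} {t : ℕ} (hq : 3 ≤ q) (ht : 3 ≤ t) : 9 * q ≤ q ^ t := by
  have h : 0 ≤ q * ((q - 3) * (q + 3)) :=
    mul_nonneg (by linarith) (mul_nonneg (by linarith) (by linarith))
  calc 9 * q ≤ q ^ 3 := by linarith [show q * ((q - 3) * (q + 3)) = q ^ 3 - 9 * q by ring]
    _ ≤ q ^ t := pow_le_pow_right₀ (by linarith) ht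

theorem isExceptional_max_of_dvd {q U V σ : ℤ} {t s : ℕ} (hq : 3 ≤ q) (ht : 3 ≤ t) (hs : s ≤ t)
    (hU : 1 ≤ U) (hU' : U ≤ 2 * (q ^ t * q) + 2 * q - 1) (hV : 1 ≤ V)
    (hV' : V ≤ 2 * (q ^ t * q) + 2 * q - 1) (hσ : σ = 1 ∨ σ = -1)
    (h : q ^ (2 * t + 1) + 1 ∣ q ^ s * U - σ * V) :
    (σ = 1 ∧ V = q ^ s * U) ∨ (U < V ∧ (q ∣ V ∨ IsExceptional q (q ^ t) V)) ∨
      (V < U ∧ (q ∣ U ∨ IsExceptional q (q ^ t) U)) := by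
  have hQ : 9 * q ≤ q ^ t := nine_mul_le_pow hq ht
  have hN : q ^ (2 * t + 1) + 1 = (q ^ t) ^ 2 * q + 1 := by ring
  rw [hN] at h
  rcases hs.lt_or_eq with hs | rfl
  · refine Or.inl (eq_mul_of_dvd_of_mul_le hq hQ (one_le_pow₀ (by linarith)) ?_ hU hU' hV hV' hσ h)
    rw [← pow_succ]
    exact pow_le_pow_right₀ (by linarith) hs
  · rcases exists_shift_of_dvd hq hQ hU hU' hV hV' hσ h with h | ⟨c, w, hc, hUw, hVw⟩
    · exact Or.inl h
    · exact Or.inr (isExceptional_max_of_shift hq hQ hU' hV hV' hc hUw hVw)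

theorem isExceptional_of_dvd_sub_mul_pow {q X Y : ℤ} {t e : ℕ} (hq : 3 ≤ q) (ht : 3 ≤ t)
    (hX' : X ≤ 2 * (q ^ t * q) + 2 * q - 1) (hY : 1 ≤ Y) (hYX : Y < X)
    (h : q ^ (2 * t + 1) + 1 ∣ X - Y * q ^ e) : q ∣ X ∨ IsExceptional q (q ^ t) X := by
  obtain ⟨s, hs, σ, hσ, h | h, -⟩ := exists_pow_le_of_dvd_sub_mul_pow h
  · rcases isExceptional_max_of_dvd hq ht hs (by linarith) hX' hY (by linarith) hσ h with
      ⟨-, h⟩ | h | h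
    · have : X ≤ q ^ s * X :=
        le_mul_of_one_le_left (by linarith) (one_le_pow₀ (by linarith))
      linarith
    · exact absurd h.1 (by linarith)
    · exact h.2
  · rcases isExceptional_max_of_dvd hq ht hs hY (by linarith) (by linarith) hX' hσ h with
      ⟨-, h⟩ | h | h
    · left
      rcases s with _ | s
      · simp at h; omega
      · rw [h, pow_succ]; exact ⟨q ^ s * Y, by ring⟩
    · exact h.2
    · exact absurd h.1 (by linarith)

/-- This gives full size `2 m` for the coset of `X`: comparing `X` with itself excludes the strict
inequalities, leaving only the trivial normal form `s = 0`, `σ = 1`. -/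
theorem dvd_exponent_of_dvd_sub_mul_pow {q X : ℤ} {t e : ℕ} (hq : 3 ≤ q) (ht : 3 ≤ t)
    (hX : 1 ≤ X) (hX' : X ≤ 2 * (q ^ t * q) + 2 * q - 1)
    (h : q ^ (2 * t + 1) + 1 ∣ X - X * q ^ e) : 2 * (2 * t + 1) ∣ e := by
  obtain ⟨s, hs, σ, hσ, h, he⟩ := exists_pow_le_of_dvd_sub_mul_pow h
  rw [or_self_iff] at h
  rcases isExceptional_max_of_dvd hq ht hs hX hX' hX hX' hσ h with ⟨h1, h⟩ | h | h
  · refine he ?_ h1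
    by_contra hs0
    have : 1 < q ^ s := one_lt_pow₀ (by linarith) hs0
    nlinarith
  · exact absurd h.1 (lt_irrefl _)
  · exact absurd h.1 (lt_irrefl _)

end CosetLeaders

/-! ### Counting cosets by their leaders. -/

section CosetCounting

/-- The congruence modulo `n`, scaled by `l` to a divisibility by `l * n`. -/
theorem mul_modEq_iff_dvd {n l N x y : ℕ} (hl : 0 < l) (hN : n * l = N) :
    x ≡ y [MOD n] ↔ (N : ℤ) ∣ (l : ℤ) * x - l * y := by
  rw [Nat.ModEq.comm, Nat.modEq_iff_dvd, ← hN, ← mul_sub, Nat.cast_mul, mul_comm (n : ℤ),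
    mul_dvd_mul_iff_left (by exact_mod_cast hl.ne')]

variable {q t l n : ℕ}

theorem pow_modEq_one (hN : n * l = q ^ (2 * t + 1) + 1) :
    q ^ (2 * (2 * t + 1)) ≡ 1 [MOD n] := by
  rw [Nat.ModEq.comm, Nat.modEq_iff_dvd]
  refine ⟨l * ((q : ℤ) ^ (2 * t + 1) - 1), ?_⟩
  have h : (n : ℤ) * l = (q : ℤ) ^ (2 * t + 1) + 1 := by exact_mod_cast hN
  rw [← mul_assoc, h, pow_mul']; push_cast; ring

theorem pow_mul_modEq_one (hN : n * l = q ^ (2 * t + 1) + 1) (k : ℕ) :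
    q ^ (2 * (2 * t + 1) * k) ≡ 1 [MOD n] := by
  simpa [pow_mul] using (pow_modEq_one hN).pow k

/-- Since `q ^ (2 m) ≡ 1`, the inverse of `q ^ e` is `q ^ ((2 m - 1) e)`. -/
theorem modEq_mul_pow_of_mul_pow_modEq (hN : n * l = q ^ (2 * t + 1) + 1) {x y e : ℕ}
    (h : x * q ^ e ≡ y [MOD n]) :
    x ≡ y * q ^ ((2 * (2 * t + 1) - 1) * e) [MOD n] := by
  refine Nat.ModEq.trans ?_ (h.mul_right _)
  rw [mul_assoc, ← pow_add, show e + (2 * (2 * t + 1) - 1) * e = 2 * (2 * t + 1) * e by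
    rw [← one_add_mul]; congr 1; omega]
  simpa using ((pow_mul_modEq_one hN e).mul_left x).symm

theorem modEq_mul_pow_mod (hN : n * l = q ^ (2 * t + 1) + 1) (i e : ℕ) :
    i * q ^ e ≡ i * q ^ (e % (2 * (2 * t + 1))) [MOD n] := by
  conv_lhs => rw [← Nat.div_add_mod e (2 * (2 * t + 1)), pow_add]
  simpa using ((pow_mul_modEq_one hN _).mul_right _).mul_left i

/-- `i` is prime to `q` and is the least positive element of its coset. -/
def IsLeader (q t l i : ℕ) : Prop :=
  ¬ q ∣ i ∧ ¬ IsExceptional q ((q : ℤ) ^ t) ((l : ℤ) * i)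

theorem coprime_of_mul_eq (hN : n * l = q ^ (2 * t + 1) + 1) : Nat.Coprime q n := by
  have h1 : Nat.gcd q n ∣ q ^ (2 * t + 1) := (Nat.gcd_dvd_left q n).trans
    (dvd_pow_self q (by omega))
  have h2 : Nat.gcd q n ∣ q ^ (2 * t + 1) + 1 := hN ▸ (Nat.gcd_dvd_right q n).mul_right l
  exact Nat.dvd_one.1 ((Nat.dvd_add_right h1).1 h2)

theorem injOn_mul_pow_mod (hq : 3 ≤ q) (ht : 3 ≤ t) (hl : 0 < l)
    (hN : n * l = q ^ (2 * t + 1) + 1) {i : ℕ} (hi : 1 ≤ i)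
    (hi' : (l : ℤ) * i ≤ 2 * ((q : ℤ) ^ t * q) + 2 * q - 1) :
    Set.InjOn (fun e => i * q ^ e % n) (Finset.range (2 * (2 * t + 1))) := by
  have key : ∀ a b, a ≤ b → b < 2 * (2 * t + 1) → i * q ^ a % n = i * q ^ b % n → a = b := by
    intro a b hab hb h
    obtain ⟨c, rfl⟩ := Nat.exists_eq_add_of_le hab
    have h1 : i ≡ i * q ^ c [MOD n] := by
      refine Nat.ModEq.cancel_right_of_coprime (c := q ^ a) ?_ ?_
      · rw [← Nat.coprime_iff_gcd_eq_one]
        exact ((coprime_of_mul_eq hN).pow_left a).symm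
      · rw [mul_assoc, ← pow_add, add_comm c]; exact h
    rw [mul_modEq_iff_dvd hl hN] at h1
    push_cast at h1
    rw [← mul_assoc] at h1
    have h2 := dvd_exponent_of_dvd_sub_mul_pow (by exact_mod_cast hq) ht
      (by exact_mod_cast Nat.mul_pos hl hi) hi' h1
    have := Nat.eq_zero_of_dvd_of_lt h2 (by omega)
    omega
  intro a ha b hb h
  simp only [Finset.coe_range, Set.mem_Iio] at ha hb
  rcases le_total a b with hab | hab
  · exact key a b hab hb h
  · exact (key b a hab ha h.symm).symm

theorem IsLeader.not_modEq (hq : 3 ≤ q) (ht : 3 ≤ t) (hl : 0 < l) (hlq : l ∣ q + 1)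
    (hN : n * l = q ^ (2 * t + 1) + 1) {i j e : ℕ} (hj : 1 ≤ j) (hji : j < i)
    (hi' : (l : ℤ) * i ≤ 2 * ((q : ℤ) ^ t * q) + 2 * q - 1) (hi : IsLeader q t l i) :
    ¬ i ≡ j * q ^ e [MOD n] := by
  intro h
  rw [mul_modEq_iff_dvd hl hN] at h
  push_cast at h
  rw [← mul_assoc] at h
  have hl' : (0 : ℤ) < l := by exact_mod_cast hl
  rcases isExceptional_of_dvd_sub_mul_pow (by exact_mod_cast hq) ht hi'
    (by exact_mod_cast Nat.mul_pos hl hj)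
    (mul_lt_mul_of_pos_left (by exact_mod_cast hji) hl') h with h | h
  · refine hi.1 (Nat.Coprime.dvd_of_dvd_mul_left (m := l) ?_ (by exact_mod_cast h))
    have h1 : Nat.gcd q l ∣ q + 1 := (Nat.gcd_dvd_right q l).trans hlq
    exact Nat.dvd_one.1 ((Nat.dvd_add_right (Nat.gcd_dvd_left q l)).1 h1)
  · exact hi.2 h

theorem exists_modEq_of_not_isLeader (hq : 3 ≤ q) (ht : 3 ≤ t) (ht2 : Odd t) (hl : 0 < l)
    (hlq : l ∣ q + 1) (hN : n * l = q ^ (2 * t + 1) + 1) {i : ℕ} (hi : 1 ≤ i)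
    (hi' : (l : ℤ) * i ≤ 2 * ((q : ℤ) ^ t * q) + 2 * q - 1) (h : ¬ IsLeader q t l i) :
    ∃ j e, 1 ≤ j ∧ j < i ∧ i ≡ j * q ^ e [MOD n] := by
  by_cases hqi : q ∣ i
  · obtain ⟨j, rfl⟩ := hqi
    have hj : 1 ≤ j := Nat.pos_of_ne_zero (by rintro rfl; simp at hi)
    exact ⟨j, 1, hj, by nlinarith, by rw [pow_one, mul_comm]⟩
  · have hex : IsExceptional q ((q : ℤ) ^ t) ((l : ℤ) * i) := by
      by_contra hne; exact h ⟨hqi, hne⟩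
    have hq3 : (3 : ℤ) ≤ q := by exact_mod_cast hq
    have hlQ : (l : ℤ) ∣ (q : ℤ) ^ t + 1 := by
      have h1 := ht2.add_dvd_pow_add_pow (q : ℤ) 1
      rw [one_pow] at h1
      exact (show (l : ℤ) ∣ q + 1 by exact_mod_cast hlq).trans h1
    have hNZ : (n : ℤ) * l = ((q : ℤ) ^ t) ^ 2 * q + 1 := by
      rw [← pow_mul, mul_comm t, ← pow_succ]; exact_mod_cast hN
    have hqX : ¬ (q : ℤ) ∣ l * i := by
      intro h1
      refine hqi (Nat.Coprime.dvd_of_dvd_mul_left (m := l) ?_ (by exact_mod_cast h1))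
      have h1 : Nat.gcd q l ∣ q + 1 := (Nat.gcd_dvd_right q l).trans hlq
      exact Nat.dvd_one.1 ((Nat.dvd_add_right (Nat.gcd_dvd_left q l)).1 h1)
    obtain ⟨Y, hY1, hYX, ⟨j, rfl⟩, σ, hσ, hY⟩ := exists_smaller_of_isExceptional hq3
      (nine_mul_le_pow hq3 ht) hlQ (Dvd.intro_left _ hNZ) hi' (Dvd.intro _ rfl) hqX hex
    have hl' : (0 : ℤ) < l := by exact_mod_cast hl
    have hj : 0 < j := pos_of_mul_pos_right (by linarith) hl'.le
    have hji : j < i := lt_of_mul_lt_mul_left hYX hl'.le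
    lift j to ℕ using hj.le
    have hjpos : 1 ≤ j := by exact_mod_cast hj
    have hjlt : j < i := by exact_mod_cast hji
    have hcong : ∀ x y : ℕ, (((q : ℤ) ^ t) ^ 2 * q + 1) ∣ (q : ℤ) ^ t * (l * x) - σ * (l * y) →
        ∃ e, x * q ^ t ≡ y * q ^ e [MOD n] := by
      intro x y hd
      rw [← hNZ, show (q : ℤ) ^ t * (l * x) - σ * (l * y) = (q ^ t * x - σ * y) * l by ring,
        mul_dvd_mul_iff_right hl'.ne'] at hd
      rcases hσ with rfl | rfl
      · refine ⟨0, ?_⟩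
        rw [Nat.ModEq.comm, Nat.modEq_iff_dvd]
        push_cast
        rwa [pow_zero, mul_one, mul_comm (x : ℤ), ← one_mul (y : ℤ)]
      -- The sign `-1` is itself the power `q ^ (2 t + 1)` modulo `n`.
      · refine ⟨2 * t + 1, ?_⟩
        rw [Nat.ModEq.comm, Nat.modEq_iff_dvd]
        have h2 : (n : ℤ) ∣ q ^ (2 * t + 1) + 1 := ⟨l, by exact_mod_cast hN.symm⟩
        push_cast
        have := dvd_sub hd (h2.mul_left (y : ℤ))
        rwa [show (q : ℤ) ^ t * x - -1 * y - y * (q ^ (2 * t + 1) + 1) =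
          x * q ^ t - y * q ^ (2 * t + 1) by ring] at this
    rcases hY with hY | hY
    · obtain ⟨e, he⟩ := hcong i j hY
      have := modEq_mul_pow_of_mul_pow_modEq hN he
      rw [mul_assoc, ← pow_add] at this
      exact ⟨j, _, hjpos, hjlt, this⟩
    · obtain ⟨e, he⟩ := hcong j i hY
      have := modEq_mul_pow_of_mul_pow_modEq hN he.symm
      rw [mul_assoc, ← pow_add] at this
      exact ⟨j, _, hjpos, hjlt, this⟩

-- Induction on `D`: a leader `D + 1` contributes a full coset disjoint from the earlier ones, while
-- a non-leader lies in the coset of a smaller positive integer and contributes nothing.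
open Classical in
theorem card_cosetUnion_Ico_one (hq : 3 ≤ q) (ht : 3 ≤ t) (ht2 : Odd t) (hl : 0 < l)
    (hlq : l ∣ q + 1) (hn : 0 < n) (hN : n * l = q ^ (2 * t + 1) + 1) {D : ℕ}
    (hD : (l : ℤ) * D ≤ 2 * ((q : ℤ) ^ t * q) + 2 * q - 1) :
    (cosetUnion n q (Set.Ico 1 (D + 1))).card =
      2 * (2 * t + 1) * ((Finset.Ico 1 (D + 1)).filter (IsLeader q t l)).card := by
  induction D with
  | zero =>
    simp [Finset.card_eq_zero, Finset.eq_empty_iff_forall_notMem, mem_cosetUnion]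
  | succ D ih =>
    have hl' : (0 : ℤ) < l := by exact_mod_cast hl
    have ih := ih (le_trans (by push_cast; nlinarith) hD)
    have hIco : Finset.Ico 1 (D + 1 + 1) = insert (D + 1) (Finset.Ico 1 (D + 1)) :=
      (Finset.insert_Ico_right_eq_Ico_add_one (by omega)).symm
    have hnot : D + 1 ∉ (Finset.Ico 1 (D + 1)).filter (IsLeader q t l) := by simp
    by_cases hlead : IsLeader q t l (D + 1)
    · rw [hIco, Finset.filter_insert, if_pos hlead, Finset.card_insert_of_notMem hnot,
        mul_add, ← ih, mul_one]
      set I := (Finset.range (2 * (2 * t + 1))).image fun e => (D + 1) * q ^ e % n with hI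
      have hIcard : I.card = 2 * (2 * t + 1) := by
        rw [hI, Finset.card_image_of_injOn
          (injOn_mul_pow_mod hq ht hl hN (by omega) (by exact_mod_cast hD)), Finset.card_range]
      have hdisj : Disjoint (cosetUnion n q (Set.Ico 1 (D + 1))) I := by
        rw [Finset.disjoint_left]
        intro x hx hxI
        obtain ⟨-, j, ⟨hj1, hj2⟩, e, hje⟩ := mem_cosetUnion.1 hx
        obtain ⟨e', -, rfl⟩ := Finset.mem_image.1 hxI
        have h1 := modEq_mul_pow_of_mul_pow_modEq hN ((Nat.mod_modEq _ _).symm.trans hje)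
        rw [mul_assoc, ← pow_add] at h1
        exact hlead.not_modEq hq ht hl hlq hN hj1 hj2 hD h1
      rw [← hIcard, ← Finset.card_union_of_disjoint hdisj]
      congr 1
      ext x
      rw [Finset.mem_union, mem_cosetUnion, mem_cosetUnion, hI, Finset.mem_image]
      constructor
      · rintro ⟨hx, j, ⟨hj1, hj2⟩, e, he⟩
        rcases (Nat.lt_succ_iff.1 hj2).lt_or_eq with hj | rfl
        · exact Or.inl ⟨hx, j, ⟨hj1, hj⟩, e, he⟩
        · refine Or.inr ⟨e % (2 * (2 * t + 1)), Finset.mem_range.2 (Nat.mod_lt _ (by omega)), ?_⟩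
          have := he.trans (modEq_mul_pow_mod hN _ e)
          rw [← this, Nat.mod_eq_of_lt hx]
      · rintro (⟨hx, j, ⟨hj1, hj2⟩, e, he⟩ | ⟨e, -, rfl⟩)
        · exact ⟨hx, j, ⟨hj1, by omega⟩, e, he⟩
        · exact ⟨Nat.mod_lt _ hn, D + 1, ⟨by omega, by omega⟩, e, Nat.mod_modEq _ _⟩
    · rw [hIco, Finset.filter_insert, if_neg hlead, ← ih]
      congr 1
      obtain ⟨j₀, e₀, hj₁, hj₂, hj₃⟩ :=
        exists_modEq_of_not_isLeader hq ht ht2 hl hlq hN (by omega) hD hlead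
      ext x
      rw [mem_cosetUnion, mem_cosetUnion]
      refine and_congr_right fun hx => ⟨?_, ?_⟩
      · rintro ⟨j, ⟨hj1, hj2⟩, e, he⟩
        rcases (Nat.lt_succ_iff.1 hj2).lt_or_eq with hj | rfl
        · exact ⟨j, ⟨hj1, hj⟩, e, he⟩
        · refine ⟨j₀, ⟨hj₁, hj₂⟩, e₀ + e, he.trans ?_⟩
          rw [pow_add, ← mul_assoc]
          exact hj₃.mul_right _
      · rintro ⟨j, ⟨hj1, hj2⟩, e, he⟩
        exact ⟨j, ⟨hj1, by omega⟩, e, he⟩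

/-- The coset of `0` is `{0}`, and no `j` with `1 ≤ j ≤ D < n` can reach it because `q` is prime to
`n`. -/
theorem card_cosetUnion_Ico_zero (hn : 0 < n) (hN : n * l = q ^ (2 * t + 1) + 1) {D : ℕ}
    (hD : D < n) :
    (cosetUnion n q (Set.Ico 0 (D + 1))).card = (cosetUnion n q (Set.Ico 1 (D + 1))).card + 1 := by
  have h0 : 0 ∉ cosetUnion n q (Set.Ico 1 (D + 1)) := by
    rw [mem_cosetUnion]
    rintro ⟨-, j, ⟨hj1, hj2⟩, e, he⟩
    have h1 : n ∣ j * q ^ e := (Nat.modEq_zero_iff_dvd.1 he.symm)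
    have h2 := ((coprime_of_mul_eq hN).pow_left e).symm.dvd_of_dvd_mul_right h1
    have := Nat.le_of_dvd (by omega) h2
    omega
  rw [← Finset.card_insert_of_notMem h0]
  congr 1
  ext x
  rw [Finset.mem_insert, mem_cosetUnion, mem_cosetUnion]
  constructor
  · rintro ⟨hx, j, ⟨-, hj2⟩, e, he⟩
    rcases Nat.eq_zero_or_pos j with rfl | hj
    · left
      rw [zero_mul] at he
      exact he.eq_of_lt_of_lt hx hn
    · exact Or.inr ⟨hx, j, ⟨hj, hj2⟩, e, he⟩
  · rintro (rfl | ⟨hx, j, ⟨hj1, hj2⟩, e, he⟩)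
    · exact ⟨hn, 0, ⟨le_rfl, by omega⟩, 0, by simp; rfl⟩
    · exact ⟨hx, j, ⟨by omega, hj2⟩, e, he⟩

end CosetCounting

/-! ### Counting leaders up to a bound. -/

section LeaderCounting

theorem mul_sub_ediv_le {q D : ℤ} (hq : 0 < q) : q * (D - D / q) ≤ (q - 1) * (D + 1) := by
  have h1 := Int.emod_add_mul_ediv D q
  have h2 := Int.emod_lt_of_pos D hq
  nlinarith

/-- The windows become intervals with rounded ends. For the isolated points, `q ≡ Q ≡ -1` modulo
`l`, so `l ∣ Q w - 1` forces `w = q + l r` and `l ∣ Q w + 1` forces `w = q + 2 + l a`. -/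
theorem isExceptional_mul_iff {q Q l A B i : ℤ} (hl : 2 ≤ l)
    (hlq : l ∣ q + 1) (hlQ : l ∣ Q + 1) (hA : l * A = Q * q - 1) (hB : l * B = 2 * (Q + 1)) :
    IsExceptional q Q (l * i) ↔ (A - (q - 2) / l ≤ i ∧ i ≤ A + q / l) ∨
      2 * A - (2 * q - 3) / l ≤ i ∨ (∃ r, 1 ≤ r ∧ r ≤ (q - 1) / l ∧ i = A + r * Q) ∨
      ∃ a, 0 ≤ a ∧ a ≤ (q - 3) / l ∧ i = A + B + a * Q := by
  have hl0 : 0 < l := by linarith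
  have e1 : A - (q - 2) / l ≤ i ↔ Q * q - q < l * i := by
    rw [sub_le_comm, Int.le_ediv_iff_mul_le hl0, sub_mul, mul_comm A, mul_comm i, hA]
    constructor <;> intro h <;> linarith
  have e2 : i ≤ A + q / l ↔ l * i < Q * q + q := by
    rw [← sub_le_iff_le_add', Int.le_ediv_iff_mul_le hl0, sub_mul, mul_comm A, mul_comm i, hA]
    constructor <;> intro h <;> linarith
  have e3 : 2 * A - (2 * q - 3) / l ≤ i ↔ 2 * (Q * q) - 2 * q < l * i := by
    rw [sub_le_comm, Int.le_ediv_iff_mul_le hl0, sub_mul, mul_assoc, mul_comm A, mul_comm i, hA]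
    constructor <;> intro h <;> linarith
  rw [IsExceptional, e1, e2, e3]
  refine or_congr_right (or_congr_right ?_)
  constructor
  · rintro ⟨w, hw1, hw2, hX | hX⟩
    · left
      obtain ⟨r, hr⟩ : l ∣ w - q := by
        have h1 : l ∣ (Q + 1) * w - l * i - (q + 1) :=
          dvd_sub (dvd_sub (hlQ.mul_right w) (Dvd.intro _ rfl)) hlq
        rwa [hX, show (Q + 1) * w - (Q * w - 1) - (q + 1) = w - q by ring] at h1
      refine ⟨r, ?_, ?_, ?_⟩
      · have : l * 0 < l * r := by linarith
        exact lt_of_mul_lt_mul_left this hl0.le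
      · rw [Int.le_ediv_iff_mul_le hl0]; linarith
      · have : l * i = l * (A + r * Q) := by
          rw [hX, mul_add, hA, ← mul_assoc, ← hr]
          ring
        exact mul_left_cancel₀ hl0.ne' this
    · right
      obtain ⟨a, ha⟩ : l ∣ w - q - 2 := by
        have h1 : l ∣ (Q + 1) * w - l * i - (q + 1) :=
          dvd_sub (dvd_sub (hlQ.mul_right w) (Dvd.intro _ rfl)) hlq
        rwa [hX, show (Q + 1) * w - (Q * w + 1) - (q + 1) = w - q - 2 by ring] at h1
      refine ⟨a, ?_, ?_, ?_⟩
      · have : l * (-1) < l * a := by linarith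
        exact lt_of_mul_lt_mul_left this hl0.le
      · rw [Int.le_ediv_iff_mul_le hl0]; linarith
      · have : l * i = l * (A + B + a * Q) := by
          rw [hX, mul_add, mul_add, hA, hB, ← mul_assoc, ← ha]
          ring
        exact mul_left_cancel₀ hl0.ne' this
  · rintro (⟨r, hr1, hr2, rfl⟩ | ⟨a, ha1, ha2, rfl⟩)
    · rw [Int.le_ediv_iff_mul_le hl0] at hr2
      exact ⟨q + l * r, by nlinarith, by linarith, Or.inl (by rw [mul_add, hA]; ring)⟩
    · rw [Int.le_ediv_iff_mul_le hl0] at ha2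
      exact ⟨q + 2 + l * a, by nlinarith, by linarith,
        Or.inr (by rw [mul_add, mul_add, hA, hB]; ring)⟩

/-- Below the upper window, exceptional points can be subtracted from the non-multiples of `q`
without overlap. The only multiple of `q` in the first window is `Q q`, which is `≡ 1` modulo `l`;
and `Q w ∓ 1` is `∓ 1` modulo `q`. -/
theorem not_dvd_of_isExceptional {q Q l A i : ℤ} (hq : 3 ≤ q) (hqQ : q ∣ Q) (hl : 2 ≤ l)
    (hA : l * A = Q * q - 1) (h : IsExceptional q Q (l * i))
    (h' : l * i ≤ 2 * (Q * q) - 2 * q) : ¬ q ∣ i := by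
  intro hqi
  have hqX : q ∣ l * i := hqi.mul_left l
  have hone : ∀ x, q ∣ x → x ≠ 1 ∧ x ≠ -1 := by
    intro x hx
    constructor <;> rintro rfl
    · have := Int.le_of_dvd one_pos hx; linarith
    · have := Int.le_of_dvd one_pos (dvd_neg.1 hx); linarith
  rcases h with ⟨h1, h2⟩ | h | ⟨w, -, -, hX | hX⟩
  · have h3 : q ∣ l * i - Q * q := dvd_sub hqX (Dvd.intro_left _ rfl)
    have h4 := Int.eq_zero_of_abs_lt_dvd h3 (by rw [abs_lt]; constructor <;> linarith)
    have h5 : l ∣ 1 := ⟨i - A, by rw [mul_sub, hA]; linarith⟩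
    have := Int.le_of_dvd one_pos h5
    linarith
  · linarith
  · exact (hone _ (dvd_sub hqX (hqQ.mul_right w))).2 (by rw [hX]; ring)
  · exact (hone _ (dvd_sub hqX (hqQ.mul_right w))).1 (by rw [hX]; ring)

open Classical in
theorem card_filter_not_dvd (q D : ℕ) :
    (((Finset.Ico 1 (D + 1)).filter fun i => ¬ q ∣ i).card : ℤ) = D - (D : ℤ) / q := by
  have h1 : Finset.Ico 1 (D + 1) = Finset.Ioc 0 D := by ext; simp; omega
  have h2 := Finset.card_filter_add_card_filter_not (s := Finset.Ioc 0 D) (fun i => q ∣ i)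
  have h3 := Nat.Ioc_filter_dvd_card_eq_div D q
  rw [Nat.card_Ioc] at h2
  rw [h1]
  have h4 : ((D / q : ℕ) : ℤ) = (D : ℤ) / q := by push_cast; rfl
  rw [← h4, ← h3]
  omega

open Classical in
/-- The number of leaders up to `D`, below the range in which there are none. -/
theorem card_filter_isLeader {q t l D : ℕ} {A B x y : ℤ} (hq : 3 ≤ q) (ht : 3 ≤ t) (hl : 2 ≤ l)
    (hlq : (l : ℤ) ∣ q + 1) (hlQ : (l : ℤ) ∣ (q : ℤ) ^ t + 1)
    (hA : (l : ℤ) * A = (q : ℤ) ^ t * q - 1) (hB : (l : ℤ) * B = 2 * ((q : ℤ) ^ t + 1))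
    (hlow : 1 ≤ A - ((q : ℤ) - 2) / l)
    (hD : (D : ℤ) < 2 * A - (2 * (q : ℤ) - 3) / l)
    (hx0 : 0 ≤ x) (hx1 : x ≤ ((q : ℤ) - 1) / l) (hxD : 0 < x → A + x * (q : ℤ) ^ t ≤ D)
    (hxD' : x = ((q : ℤ) - 1) / l ∨ (D : ℤ) < A + (x + 1) * (q : ℤ) ^ t)
    (hy0 : 0 ≤ y) (hy1 : y ≤ ((q : ℤ) - 3) / l + 1)
    (hyD : 0 < y → A + B + (y - 1) * (q : ℤ) ^ t ≤ D)
    (hyD' : y = ((q : ℤ) - 3) / l + 1 ∨ (D : ℤ) < A + B + y * (q : ℤ) ^ t) :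
    (((Finset.Ico 1 (D + 1)).filter (IsLeader q t l)).card : ℤ) = D - (D : ℤ) / q
      - (Finset.Icc (A - ((q : ℤ) - 2) / l) (min (D : ℤ) (A + (q : ℤ) / l))).card - x - y := by
  have hq3 : (3 : ℤ) ≤ q := by exact_mod_cast hq
  have hl2 : (2 : ℤ) ≤ l := by exact_mod_cast hl
  have hl0 : (0 : ℤ) < l := by linarith
  have hQ := nine_mul_le_pow hq3 ht
  have hqQ : (q : ℤ) ∣ (q : ℤ) ^ t := dvd_pow_self _ (by omega)
  set Q : ℤ := (q : ℤ) ^ t with hQdef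
  have hQ0 : 0 < Q := by linarith
  have hf0 : (q : ℤ) / l ≤ q := Int.ediv_le_self _ (by linarith)
  have hAlt : 0 < A := by
    have : 0 ≤ ((q : ℤ) - 2) / l := Int.ediv_nonneg (by linarith) hl0.le
    linarith
  have hBpos : (q : ℤ) / l < B := by
    rw [Int.ediv_lt_iff_lt_mul hl0, mul_comm, hB]; linarith
  -- The exceptional points up to `D`: the part of the window around `A`, then `x` points `A + r Q`
  -- and `y` points `A + B + a Q`, where the hypotheses make `x` and `y` exactly the numbers of
  -- points passed.
  set E : Finset ℤ := (Finset.Icc (A - ((q : ℤ) - 2) / l) (min (D : ℤ) (A + (q : ℤ) / l)) ∪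
    (Finset.Icc 1 x).image fun r => A + r * Q) ∪ (Finset.Icc 0 (y - 1)).image
      fun a => A + B + a * Q with hE
  have hEcard : (E.card : ℤ) =
      (Finset.Icc (A - ((q : ℤ) - 2) / l) (min (D : ℤ) (A + (q : ℤ) / l))).card + x + y := by
    have hinj1 : Function.Injective fun r : ℤ => A + r * Q := fun a b h =>
      mul_right_cancel₀ hQ0.ne' (add_left_cancel h)
    have hinj2 : Function.Injective fun r : ℤ => A + B + r * Q := fun a b h =>
      mul_right_cancel₀ hQ0.ne' (add_left_cancel h)
    rw [hE, Finset.card_union_of_disjoint, Finset.card_union_of_disjoint,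
      Finset.card_image_of_injective _ hinj1, Finset.card_image_of_injective _ hinj2]
    · simp only [Int.card_Icc]; push_cast
      rw [Int.toNat_of_nonneg (by linarith : 0 ≤ x + 1 - 1),
        Int.toNat_of_nonneg (by linarith : 0 ≤ y - 1 + 1 - 0)]
      ring
    · rw [Finset.disjoint_left]
      intro i hi hi'
      obtain ⟨r, hr, rfl⟩ := Finset.mem_image.1 hi'
      simp only [Finset.mem_Icc, le_min_iff] at hi hr
      nlinarith
    · rw [Finset.disjoint_left]
      intro i hi hi'
      obtain ⟨a, ha, rfl⟩ := Finset.mem_image.1 hi'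
      simp only [Finset.mem_union, Finset.mem_Icc, le_min_iff, Finset.mem_image] at hi ha
      rcases hi with hi | ⟨r, hr, hra⟩
      · nlinarith
      -- A coincidence would give `B = (r - a) Q`, while `l B = 2 Q + 2`.
      · have h1 : Q ∣ 2 := by
          refine ⟨l * r - l * a - 2, ?_⟩
          have : (l : ℤ) * B = l * (r * Q - a * Q) := by congr 1; linarith
          rw [hB] at this
          linarith
        have := Int.le_of_dvd two_pos h1
        linarith
  have himage : ((Finset.Ico 1 (D + 1)).filter fun i : ℕ => ¬ q ∣ i ∧
      IsExceptional q Q ((l : ℤ) * i)).image (fun i : ℕ => (i : ℤ)) = E := by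
    have hiff := fun i : ℤ => isExceptional_mul_iff (i := i) hl2 hlq hlQ hA hB
    have hmem : ∀ i : ℤ, i ∈ E ↔ i ≤ D ∧ 1 ≤ i ∧ IsExceptional q Q (l * i) := by
      intro i
      rw [hiff, hE]
      simp only [Finset.mem_union, Finset.mem_Icc, le_min_iff, Finset.mem_image]
      constructor
      · rintro ((⟨h1, h2, h3⟩ | ⟨r, ⟨h1, h2⟩, rfl⟩) | ⟨a, ⟨h1, h2⟩, rfl⟩)
        · exact ⟨h2, by linarith, Or.inl ⟨h1, h3⟩⟩
        · have h3 : r * Q ≤ x * Q := by gcongr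
          refine ⟨by linarith [hxD (by linarith)], ?_,
            Or.inr (Or.inr (Or.inl ⟨r, h1, by linarith, rfl⟩))⟩
          have : 0 < r * Q := mul_pos (by linarith) hQ0
          linarith
        · have h3 : a * Q ≤ (y - 1) * Q := by gcongr
          refine ⟨by linarith [hyD (by linarith)], ?_,
            Or.inr (Or.inr (Or.inr ⟨a, h1, by linarith, rfl⟩))⟩
          have : 0 ≤ a * Q := mul_nonneg (by linarith) hQ0.le
          have : 0 ≤ (q : ℤ) / l := Int.ediv_nonneg (by linarith) hl0.le
          linarith
      · rintro ⟨h1, h2, ⟨h3, h4⟩ | h | ⟨r, h3, h4, rfl⟩ | ⟨a, h3, h4, rfl⟩⟩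
        · exact Or.inl (Or.inl ⟨h3, h1, h4⟩)
        · exact absurd h (by linarith)
        · refine Or.inl (Or.inr ⟨r, ⟨h3, ?_⟩, rfl⟩)
          rcases hxD' with rfl | h
          · exact h4
          · have : r * Q < (x + 1) * Q := by linarith
            exact Int.lt_add_one_iff.1 (lt_of_mul_lt_mul_right this hQ0.le)
        · refine Or.inr ⟨a, ⟨h3, ?_⟩, rfl⟩
          rcases hyD' with rfl | h
          · linarith
          · have : a * Q < y * Q := by linarith
            have := lt_of_mul_lt_mul_right this hQ0.le
            linarith
    ext i
    rw [hmem, Finset.mem_image]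
    simp only [Finset.mem_filter, Finset.mem_Ico]
    constructor
    · rintro ⟨j, ⟨⟨h1, h2⟩, -, h3⟩, rfl⟩
      exact ⟨by exact_mod_cast Nat.lt_succ_iff.1 h2, by exact_mod_cast h1, h3⟩
    · rintro ⟨h1, h2, h3⟩
      lift i to ℕ using by linarith
      refine ⟨i, ⟨⟨by exact_mod_cast h2, Nat.lt_succ_iff.2 (by exact_mod_cast h1)⟩, ?_, h3⟩, rfl⟩
      have hbound : (l : ℤ) * i ≤ 2 * (Q * q) - 2 * q := by
        have h4 : ¬ (2 * A - (2 * (q : ℤ) - 3) / l ≤ i) := by linarith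
        rw [sub_le_comm, Int.le_ediv_iff_mul_le hl0] at h4
        linarith
      intro h
      exact not_dvd_of_isExceptional hq3 hqQ hl2 hA h3 hbound (by exact_mod_cast h)
  have hsplit := Finset.card_filter_add_card_filter_not
    (s := (Finset.Ico 1 (D + 1)).filter fun i => ¬ q ∣ i)
    (fun i : ℕ => IsExceptional q Q ((l : ℤ) * i))
  rw [Finset.filter_filter, Finset.filter_filter,
    ← Finset.card_image_of_injective _ (Nat.cast_injective (R := ℤ)), himage] at hsplit
  have hlead : (Finset.Ico 1 (D + 1)).filter (IsLeader q t l) =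
      (Finset.Ico 1 (D + 1)).filter fun i => ¬ q ∣ i ∧ ¬ IsExceptional q Q ((l : ℤ) * i) := by
    ext; simp only [Finset.mem_filter, IsLeader, hQdef]
  rw [hlead, ← card_filter_not_dvd q D, ← hsplit]
  push_cast
  rw [hEcard]
  ring

-- From `κ` on every point is exceptional, so the count is frozen; this is why `τ` replaces `ε`.
open Classical in
theorem card_filter_isLeader_of_le {q t l C D : ℕ} {A : ℤ} (hl : 2 ≤ l)
    (hA : (l : ℤ) * A = (q : ℤ) ^ t * q - 1)
    (hC : 2 * A - (2 * (q : ℤ) - 3) / l ≤ C + 1) (hCD : C ≤ D) :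
    (Finset.Ico 1 (D + 1)).filter (IsLeader q t l) =
      (Finset.Ico 1 (C + 1)).filter (IsLeader q t l) := by
  have hl0 : (0 : ℤ) < l := by exact_mod_cast (by omega : 0 < l)
  ext i
  simp only [Finset.mem_filter, Finset.mem_Ico]
  refine and_congr_left fun hi => ⟨fun h => ⟨h.1, ?_⟩, fun h => ⟨h.1, by omega⟩⟩
  by_contra hcon
  refine hi.2 (Or.inr (Or.inl ?_))
  have h1 : 2 * A - (2 * (q : ℤ) - 3) / l ≤ i :=
    hC.trans (by exact_mod_cast not_lt.1 hcon)
  rw [sub_le_comm, Int.le_ediv_iff_mul_le hl0] at h1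
  linarith

theorem card_filter_isLeader_le (q t l D : ℕ) [DecidablePred (IsLeader q t l)] :
    (((Finset.Ico 1 (D + 1)).filter (IsLeader q t l)).card : ℤ) ≤ D - (D : ℤ) / q := by
  classical
  rw [← card_filter_not_dvd q D]
  refine Nat.cast_le.2 (Finset.card_le_card fun i hi => ?_)
  rw [Finset.mem_filter] at hi ⊢
  exact ⟨hi.1, hi.2.1⟩

theorem sq_mul_le_pow {q t : ℕ} (hq : 3 ≤ q) (ht : 3 ≤ t) : q ^ 2 * t ≤ q ^ t := by
  induction t, ht using Nat.le_induction with
  | base => rw [pow_succ q 2]; gcongr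
  | succ t ht ih =>
    calc q ^ 2 * (t + 1) ≤ q ^ 2 * t * 3 := by nlinarith [pow_pos (by omega : 0 < q) 2]
      _ ≤ q ^ t * q := by gcongr
      _ = q ^ (t + 1) := (pow_succ q t).symm

/-- This keeps both codes nonzero, as the distance bounds require. The left side is of order `t Q q
/ λ` against `n ≈ Q² q / λ`, and `q² t ≤ Q` settles the comparison. -/
theorem two_mul_mul_card_add_one_lt {q t l n D : ℕ} {L : ℤ} (hq : 3 ≤ q) (ht : 3 ≤ t)
    (hl : 2 ≤ l) (hl' : 2 * l ≤ q + 1) (hN : n * l = q ^ (2 * t + 1) + 1)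
    (hD : (l : ℤ) * D ≤ 2 * ((q : ℤ) ^ t * q) + 2 * q - 1)
    (hL : L ≤ D - (D : ℤ) / q) : 2 * (2 * (t : ℤ) + 1) * L + 1 < n := by
  have hq3 : (3 : ℤ) ≤ q := by exact_mod_cast hq
  have ht3 : (3 : ℤ) ≤ t := by exact_mod_cast ht
  have hl2 : (2 : ℤ) ≤ l := by exact_mod_cast hl
  have hlq' : 2 * (l : ℤ) ≤ q + 1 := by exact_mod_cast hl'
  have hNZ : (n : ℤ) * l = ((q : ℤ) ^ t) ^ 2 * q + 1 := by
    rw [← pow_mul, mul_comm t, ← pow_succ]; exact_mod_cast hN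
  have hQ := nine_mul_le_pow hq3 ht
  have hQt : (q : ℤ) ^ 2 * t ≤ (q : ℤ) ^ t := by exact_mod_cast sq_mul_le_pow hq ht
  have hqd := mul_sub_ediv_le (D := (D : ℤ)) (by linarith : (0 : ℤ) < q)
  generalize (q : ℤ) ^ t = Q at *
  generalize (q : ℤ) = r at *
  generalize (l : ℤ) = l at *
  generalize (t : ℤ) = t at *
  generalize (D : ℤ) = d at *
  have h1 : r * l * L ≤ (r - 1) * (2 * (Q * r) + 3 * r) := by
    calc r * l * L = l * (r * L) := by ring
      _ ≤ l * (r * (d - d / r)) := by gcongr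
      _ ≤ l * ((r - 1) * (d + 1)) := by gcongr
      _ = (r - 1) * (l * d + l) := by ring
      _ ≤ (r - 1) * (2 * (Q * r) + 3 * r) := by
        apply mul_le_mul_of_nonneg_left <;> linarith
  -- As `t ≥ 3`, one has `12 t + 6 ≤ 14 t`; then `r² t ≤ Q`.
  have h2 : 3 * (r ^ 2 * (2 * (2 * t + 1))) ≤ 14 * Q := by nlinarith [sq_nonneg r]
  have h3 : 3 * r * (r * l * (2 * (2 * t + 1) * L + 1)) < 3 * r * (r * l * n) := by
    have h4 : 0 ≤ (r - 1) * (2 * Q + 3) := mul_nonneg (by linarith) (by linarith)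
    calc 3 * r * (r * l * (2 * (2 * t + 1) * L + 1))
        = 3 * r * (2 * (2 * t + 1)) * (r * l * L) + 3 * r ^ 2 * l := by ring
      _ ≤ 3 * r * (2 * (2 * t + 1)) * ((r - 1) * (2 * (Q * r) + 3 * r)) + 3 * r ^ 2 * l := by
        gcongr
      _ = 3 * (r ^ 2 * (2 * (2 * t + 1))) * ((r - 1) * (2 * Q + 3)) + 3 * r ^ 2 * l := by ring
      _ ≤ 14 * Q * ((r - 1) * (2 * Q + 3)) + 3 * r ^ 2 * r := by
        gcongr; linarith
      _ < 3 * r ^ 2 * (Q ^ 2 * r + 1) := by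
        have h5 : 0 ≤ Q * (Q - 9 * r) := mul_nonneg (by linarith) (by linarith)
        have h6 : 0 ≤ Q * (Q - 27) := mul_nonneg (by linarith) (by linarith)
        have h7 : 0 ≤ Q ^ 2 * (r - 3) := mul_nonneg (by positivity) (by linarith)
        have h8 : 0 ≤ Q ^ 2 * (r - 3) ^ 2 := by positivity
        have h9 : 0 ≤ Q ^ 2 * (r - 3) ^ 3 := mul_nonneg (by positivity)
          (pow_nonneg (by linarith) 3)
        have h10 : 0 ≤ r * (Q ^ 2 - 81 * r ^ 2) := mul_nonneg (by linarith) (by nlinarith)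
        have h11 : 0 ≤ (r - 3) * (Q * (Q - 27)) := mul_nonneg (by linarith) h6
        nlinarith
      _ = 3 * r * (r * l * n) := by rw [mul_assoc r l, mul_comm l, hNZ]; ring
  have h12 : 0 < 3 * r := by linarith
  have h13 : 0 < r * l := by nlinarith
  exact lt_of_mul_lt_mul_left (lt_of_mul_lt_mul_left h3 h12.le) h13.le

end LeaderCounting

/-! ### From the leader count to the case formulas. -/

section DimensionFormula

theorem ceil_mul_one_sub_inv (q : ℕ) (x : ℤ) :
    ⌈(x : ℚ) * (1 - (q : ℚ)⁻¹)⌉ = x - x / q := by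
  have h1 : (x : ℚ) * (1 - (q : ℚ)⁻¹) = -(((x : ℚ) / ((q : ℕ) : ℚ))) + x := by
    rw [div_eq_mul_inv]; ring
  rw [h1, Int.ceil_add_intCast, Int.ceil_neg, Rat.floor_intCast_div_natCast]
  ring

/-- The evaluation of the number `L` of leaders below `d` in the different ranges of `d`. -/
theorem dimension_formula {l : ℕ} {q m n A B Q f₀ f₁ f₂ f₃ ε κ τ d L M : ℤ}
    (hQ0 : 0 < Q) (hB2 : l = 2 → B = Q + 1) (hBQ : l ≠ 2 → B ≤ Q)
    (hf₁2 : l = 2 → f₁ = (q - 1) / 2) (hf₃2 : l = 2 → f₃ = f₁ - 1)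
    (hf₃₁ : f₃ ≤ f₁) (hf₃ : 0 ≤ f₃) (hf₁ : 1 ≤ f₁) (hf₀ : 0 ≤ f₀) (hf₂ : 0 ≤ f₂)
    (hfB : f₀ < B) (hfQ : f₀ < Q) (hκ₁ : A + f₁ * Q < κ) (hκ₂ : A + B + f₃ * Q < κ)
    (hL : ∀ x y : ℤ, d - 1 < κ → 0 ≤ x → x ≤ f₁ → (0 < x → A + x * Q ≤ d - 1) →
      (x = f₁ ∨ d - 1 < A + (x + 1) * Q) → 0 ≤ y → y ≤ f₃ + 1 →
      (0 < y → A + B + (y - 1) * Q ≤ d - 1) → (y = f₃ + 1 ∨ d - 1 < A + B + y * Q) →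
      L = ε - (Finset.Icc (A - f₂) (min (d - 1) (A + f₀))).card - x - y)
    (hLκ : κ ≤ d - 1 → L = τ - (f₂ + f₀ + 1) - f₁ - (f₃ + 1)) :
    (l = 2 → ∀ b : ℤ, 1 ≤ b → b ≤ (q - 1) / 2 → d = A + b * Q + 1 →
        n - 2 * m * L = n - 2 * m * (ε - (f₂ + f₀) - 2 * b)) ∧
      (¬ (l = 2 ∧ ∃ b : ℤ, 1 ≤ b ∧ b ≤ (q - 1) / 2 ∧ d = A + b * Q + 1) →
        (2 ≤ d → d ≤ A + B →
          (2 ≤ d → d ≤ A - f₂ → n - 2 * m * L = n - 2 * m * ε) ∧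
          (A - f₂ < d → d ≤ A + f₀ →
            n - 2 * m * L = n - 2 * m * ε + 2 * m * (d - A + f₂)) ∧
          (A + f₀ < d → d ≤ A + B → n - 2 * m * L = n - 2 * m * (ε - (f₂ + f₀) - 1))) ∧
        (f₃ ≠ 0 → A + B < d → d ≤ A + B + f₃ * Q →
          ∀ a : ℤ, 0 ≤ a → a ≤ f₃ - 1 →
            (A + B + a * Q < d → d ≤ A + (a + 1) * Q →
              n - 2 * m * L = n - 2 * m * (ε - (f₂ + f₀) - 2 * a - 2)) ∧
            (A + (a + 1) * Q < d → d ≤ A + B + (a + 1) * Q →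
              n - 2 * m * L = n - 2 * m * (ε - (f₂ + f₀) - 2 * a - 3))) ∧
        (A + B + f₃ * Q < d → d ≤ M →
          (f₁ = f₃ →
            (A + B + f₃ * Q < d → d ≤ κ →
              n - 2 * m * L = n - 2 * m * (ε - (f₂ + f₀) - 2 * f₁ - 2)) ∧
            (κ < d → d ≤ M →
              n - 2 * m * L = n - 2 * m * (τ - (f₂ + f₀) - 2 * f₁ - 2))) ∧
          (f₁ = f₃ + 1 →
            (A + B + f₃ * Q < d → d ≤ A + f₁ * Q →
              n - 2 * m * L = n - 2 * m * (ε - (f₂ + f₀) - 2 * f₁)) ∧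
            (A + f₁ * Q < d → d ≤ κ →
              n - 2 * m * L = n - 2 * m * (ε - (f₂ + f₀) - 2 * f₁ - 1)) ∧
            (κ < d → d ≤ M →
              n - 2 * m * L = n - 2 * m * (τ - (f₂ + f₀) - 2 * f₁ - 1))))) := by
  have hmono : ∀ a b : ℤ, a ≤ b → a * Q ≤ b * Q := fun a b h => by gcongr
  have hhi : A + f₀ ≤ d - 1 →
      ((Finset.Icc (A - f₂) (min (d - 1) (A + f₀))).card : ℤ) = f₂ + f₀ + 1 := by
    intro h
    rw [min_eq_right h, Int.card_Icc]
    omega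
  have hL' : ∀ x y : ℤ, A + f₀ ≤ d - 1 → d - 1 < κ → 0 ≤ x → x ≤ f₁ →
      (0 < x → A + x * Q ≤ d - 1) →
      (x = f₁ ∨ d - 1 < A + (x + 1) * Q) → 0 ≤ y → y ≤ f₃ + 1 →
      (0 < y → A + B + (y - 1) * Q ≤ d - 1) → (y = f₃ + 1 ∨ d - 1 < A + B + y * Q) →
      L = ε - (f₂ + f₀ + 1) - x - y := by
    intro x y h0 h1 h2 h3 h4 h5 h6 h7 h8 h9
    rw [hL x y h1 h2 h3 h4 h5 h6 h7 h8 h9, hhi h0]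
  have hf₁Q := hmono 1 f₁ hf₁
  have hf₃Q := hmono 0 f₃ hf₃
  refine ⟨?_, ?_⟩
  · intro hl b hb1 hb2 hd
    have hB := hB2 hl
    have h1 := hf₁2 hl
    have h2 := hf₃2 hl
    have h3 := hmono 1 b hb1
    have h4 := hmono b f₁ (by omega)
    -- For `l = 2`, `B = Q + 1`, so `A + b Q` and `A + B + (b - 1) Q` are adjacent. Here `d - 1` is
    -- the first of them: it is counted in `x = b` and the second is not yet in `y`.
    rw [hL' b (b - 1) (by linarith) (by linarith) (by linarith) (by omega)
      (fun _ => by linarith) (Or.inr (by linarith)) (by linarith) (by linarith)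
      (fun _ => by linarith) (Or.inr (by linarith))]
    ring
  · intro hns
    have hns' : l = 2 → ∀ b, 1 ≤ b → b ≤ f₁ → d ≠ A + b * Q + 1 := fun hl b h1 h2 h3 =>
      hns ⟨hl, b, h1, by rw [← hf₁2 hl]; exact h2, h3⟩
    -- For `l ≠ 2`, `A + B + (b - 1) Q` does not come after `A + b Q`. For `l = 2` it comes one step
    -- later, and only the excluded values of `d` see the difference, so both cases share the same
    -- formulas; `hdn` is the companion bound.
    have hup : ∀ b, 1 ≤ b → b ≤ f₁ → d ≤ A + B + (b - 1) * Q → d - 1 < A + b * Q := by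
      intro b h1 h2 h3
      by_cases hl : l = 2
      · rcases lt_or_ge (d - 1) (A + b * Q) with h | h
        · exact h
        · have := hB2 hl
          exact absurd (by linarith) (hns' hl b h1 h2)
      · linarith [hBQ hl]
    have hdn : ∀ b, 1 ≤ b → b ≤ f₁ → A + b * Q < d → A + B + (b - 1) * Q ≤ d - 1 := by
      intro b h1 h2 h3
      by_cases hl : l = 2
      · have h4 := hns' hl b h1 h2
        have h5 : A + b * Q + 1 < d := lt_of_le_of_ne (by linarith) h4.symm
        have := hB2 hl
        linarith
      · linarith [hBQ hl]
    refine ⟨?_, ?_, ?_⟩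
    · intro _ hAB
      have h1 := hup 1 le_rfl hf₁ (by linarith)
      have hκ : d - 1 < κ := by linarith
      have h0 := hL 0 0 hκ le_rfl (by linarith) (fun h => absurd h (lt_irrefl _))
        (Or.inr (by linarith)) le_rfl (by linarith) (fun h => absurd h (lt_irrefl _))
        (Or.inr (by linarith))
      refine ⟨fun _ h => ?_, fun h h' => ?_, fun h _ => ?_⟩
      · rw [h0, Finset.Icc_eq_empty (by rw [not_le]; exact min_lt_of_left_lt (by linarith))]
        simp
      · have hc : ((Finset.Icc (A - f₂) (min (d - 1) (A + f₀))).card : ℤ) = d - A + f₂ := by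
          rw [min_eq_left (by linarith), Int.card_Icc]
          omega
        rw [h0, hc]
        ring
      · rw [h0, hhi (by linarith)]
        ring
    · intro _ _ _ a ha0 ha1
      have h1 := hmono 0 a ha0
      have h2 := hmono (a + 1) f₃ (by linarith)
      have h3 := hmono f₃ f₁ hf₃₁
      refine ⟨fun h h' => ?_, fun h h' => ?_⟩
      · rw [hL' a (a + 1) (by linarith) (by linarith) ha0 (by linarith)
          (fun _ => by linarith) (Or.inr (by linarith)) (by linarith) (by linarith)
          (fun _ => by linarith) (Or.inr (by linarith))]
        ring
      · have h4 := hdn (a + 1) (by linarith) (by linarith) h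
        have h5 : a + 1 = f₁ ∨ d - 1 < A + (a + 1 + 1) * Q := by
          rcases (show a + 1 ≤ f₁ by linarith).eq_or_lt with h5 | h5
          · exact Or.inl h5
          · exact Or.inr (hup (a + 1 + 1) (by linarith) (by linarith) (by linarith))
        rw [hL' (a + 1) (a + 1) (by linarith) (by linarith) (by linarith) (by linarith)
          (fun _ => by linarith) h5 (by linarith) (by linarith)
          (fun _ => by linarith) (Or.inr (by linarith))]
        ring
    · intro h _
      refine ⟨fun h13 => ⟨fun _ hκ => ?_, fun hκ _ => ?_⟩,
        fun h13 => ⟨fun _ h' => ?_, fun h' hκ => ?_, fun hκ _ => ?_⟩⟩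
      · rw [← h13] at h
        rw [hL' f₁ (f₃ + 1) (by linarith) (by linarith) (by linarith) le_rfl
          (fun _ => by linarith) (Or.inl rfl) (by linarith) le_rfl
          (fun _ => by rw [← h13]; linarith) (Or.inl rfl), ← h13]
        ring
      · rw [hLκ (by linarith), ← h13]
        ring
      · rw [h13] at h' hκ₁ ⊢
        rw [hL' f₃ (f₃ + 1) (by linarith) (by linarith) hf₃ (by linarith)
          (fun _ => by linarith) (Or.inr (by linarith)) (by linarith) le_rfl
          (fun _ => by linarith) (Or.inl rfl)]
        ring
      · rw [hL' f₁ (f₃ + 1) (by linarith) (by linarith) (by linarith) le_rfl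
          (fun _ => by linarith) (Or.inl rfl) (by linarith) le_rfl
          (fun _ => by linarith) (Or.inl rfl), h13]
        ring
      · rw [hLκ (by linarith), h13]
        ring

end DimensionFormula

/-! ### Assembly of the code parameters and the dimension formulas. -/

open Classical in
/-- The parameters of the two codes in terms of the number of leaders below the designed
distance. -/
theorem bchCode_parameters {F K : Type*} [Field F] [Fintype F] [Field K] [Algebra F K]
    {q t n l D : ℕ} {β : K} (hq : Fintype.card F = q) (hq3 : 3 ≤ q) (ht3 : 3 ≤ t) (ht : Odd t)
    (hl : l ∣ q + 1) (hl2 : 2 ≤ l) (hlq : 2 * l ≤ q + 1) (hN : n * l = q ^ (2 * t + 1) + 1)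
    (hβ : IsPrimitiveRoot β n) (hD : (l : ℤ) * D ≤ 2 * ((q : ℤ) ^ t * q) + 2 * q - 1)
    {k : ℤ} (hk : k = n - 2 * ((2 * t + 1 : ℕ) : ℤ) *
      (((Finset.Ico 1 (D + 1)).filter (IsLeader q t l)).card : ℤ)) :
    (IsLCD (bchCode F n β (D + 1) 1) ∧
        (Module.finrank F (bchCode F n β (D + 1) 1) : ℤ) = k ∧
        D + 1 ≤ minDist (bchCode F n β (D + 1) 1)) ∧
      (IsLCD (bchCode F n β (D + 1 + 1) 0) ∧
        (Module.finrank F (bchCode F n β (D + 1 + 1) 0) : ℤ) = k - 1 ∧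
        2 * (D + 1) ≤ minDist (bchCode F n β (D + 1 + 1) 0)) := by
  have hl0 : 0 < l := by omega
  have hn0 : 0 < n := Nat.pos_of_ne_zero (by rintro rfl; simp at hN)
  have hndvd : n ∣ Fintype.card F ^ (2 * t + 1) + 1 := by rw [hq]; exact ⟨l, hN.symm⟩
  -- In `F` one has `q = 0`, so `n l = q ^ (2 t + 1) + 1` becomes `1`.
  have hnF : (n : F) ≠ 0 := by
    intro h0
    have h1 : ((n * l : ℕ) : F) = ((q ^ (2 * t + 1) + 1 : ℕ) : F) := by rw [hN]
    have h2 : (q : F) = 0 := by rw [← hq]; exact Nat.cast_card_eq_zero F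
    push_cast at h1
    rw [h0, h2] at h1
    simp at h1
  have hpos := two_mul_mul_card_add_one_lt hq3 ht3 hl2 hlq hN hD
    (card_filter_isLeader_le q t l D)
  have hcoset := card_cosetUnion_Ico_one hq3 ht3 ht hl0 hl hn0 hN hD
  generalize ((Finset.Ico 1 (D + 1)).filter (IsLeader q t l)).card = L at hk hpos hcoset
  have hDn : D < n := by
    have hq3Z : (3 : ℤ) ≤ q := by exact_mod_cast hq3
    have hl0Z : (0 : ℤ) < l := by exact_mod_cast hl0
    have hQ9 := nine_mul_le_pow hq3Z ht3
    have h2 : (l : ℤ) * n = ((q : ℤ) ^ t) ^ 2 * q + 1 := by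
      rw [← pow_mul, mul_comm t, ← pow_succ, mul_comm]; exact_mod_cast hN
    have h1 : (l : ℤ) * D < l * n := by
      rw [h2]
      generalize (q : ℤ) ^ t = Q at *
      have h3 : 0 ≤ Q * q * (Q - 9 * q) :=
        mul_nonneg (mul_nonneg (by linarith) (by linarith)) (by linarith)
      have h4 : 0 ≤ Q * q * (q - 3) :=
        mul_nonneg (mul_nonneg (by linarith) (by linarith)) (by linarith)
      have h5 : 0 ≤ (q : ℤ) * (Q - 27) := mul_nonneg (by linarith) (by linarith)
      nlinarith
    exact_mod_cast lt_of_mul_lt_mul_left h1 hl0Z.le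
  have hrank₁ := finrank_bchCode_add_card hn0 hnF hβ (D + 1) 1
  have hrank₀ := finrank_bchCode_add_card hn0 hnF hβ (D + 1 + 1) 0
  rw [hq, Nat.add_sub_cancel, add_comm 1 D, hcoset] at hrank₁
  rw [hq, Nat.add_sub_cancel, zero_add, card_cosetUnion_Ico_zero hn0 hN hDn, hcoset] at hrank₀
  zify at hrank₁ hrank₀
  have hne₁ : bchCode F n β (D + 1) 1 ≠ ⊥ := by
    intro h
    rw [h, finrank_bot] at hrank₁
    push_cast at hrank₁
    linarith
  have hne₀ : bchCode F n β (D + 1 + 1) 0 ≠ ⊥ := by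
    intro h
    rw [h, finrank_bot] at hrank₀
    push_cast at hrank₀
    linarith
  refine ⟨⟨isLCD_bchCode hn0 hndvd hβ _ _, ?_, le_minDist_bchCode hn0 hβ 1 hne₁⟩,
    ⟨isLCD_bchCode hn0 hndvd hβ _ _, ?_, two_mul_le_minDist_bchCode hn0 hndvd hβ hne₀⟩⟩
  · rw [hk]; push_cast; linarith
  · rw [hk]; push_cast; linarith

/- All divisions below are between integers with a positive divisor, so `x / y` is the floor of
the quotient; the divisions in `n`, `A` and `B` are exact. -/
theorem theorem4 {F K : Type*} [Field F] [Fintype F] [Field K] [Algebra F K]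
    (q t m n lam δ : ℕ) (β : K)
    (hq : Fintype.card F = q) (hq_odd : Odd q)
    (ht : Odd t) (hm : m = 2 * t + 1) (hm5 : 5 ≤ m)
    (hlam : lam ∣ q + 1) (hlam2 : 2 ≤ lam) (hlamq : lam < q + 1)
    (hn : n = (q ^ m + 1) / lam) (hβ : IsPrimitiveRoot β n)
    (hδ1 : 2 ≤ δ)
    (hδ2 : (δ : ℤ) - 1 ≤ (2 * (q : ℤ) ^ (t + 1) + 2 * q - 1) / lam) :
    let d : ℤ := δ
    let A : ℤ := ((q : ℤ) ^ (t + 1) - 1) / lam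
    let B : ℤ := 2 * ((q : ℤ) ^ t + 1) / lam
    let Q : ℤ := (q : ℤ) ^ t
    let f₀ : ℤ := (q : ℤ) / lam
    let f₁ : ℤ := ((q : ℤ) - 1) / lam
    let f₂ : ℤ := ((q : ℤ) - 2) / lam
    let f₃ : ℤ := ((q : ℤ) - 3) / lam
    let υ : ℤ := f₂ + f₀
    let ε : ℤ := ⌈((d : ℚ) - 1) * (1 - (q : ℚ)⁻¹)⌉
    let κ : ℤ := 2 * A - (2 * (q : ℤ) - 3) / lam
    let τ : ℤ := ⌈((κ : ℚ) - 1) * (1 - (q : ℚ)⁻¹)⌉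
    ∃ k : ℤ,
      -- the two codes are LCD codes with parameters `[n, k, ≥ δ]` and `[n, k - 1, ≥ 2δ]`
      (IsLCD (bchCode F n β δ 1) ∧
        (Module.finrank F (bchCode F n β δ 1) : ℤ) = k ∧
        δ ≤ minDist (bchCode F n β δ 1)) ∧
      (IsLCD (bchCode F n β (δ + 1) 0) ∧
        (Module.finrank F (bchCode F n β (δ + 1) 0) : ℤ) = k - 1 ∧
        2 * δ ≤ minDist (bchCode F n β (δ + 1) 0)) ∧
      -- the special values of `δ` for `lam = 2`
      (lam = 2 → ∀ b : ℤ, 1 ≤ b → b ≤ ((q : ℤ) - 1) / 2 → d = A + b * Q + 1 →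
        k = n - 2 * m * (ε - υ - 2 * b)) ∧
      -- all other values of `δ`
      (¬ (lam = 2 ∧ ∃ b : ℤ, 1 ≤ b ∧ b ≤ ((q : ℤ) - 1) / 2 ∧ d = A + b * Q + 1) →
        -- (1)
        (2 ≤ d → d ≤ A + B →
          (2 ≤ d → d ≤ A - f₂ → k = n - 2 * m * ε) ∧
          (A - f₂ < d → d ≤ A + f₀ → k = n - 2 * m * ε + 2 * m * (d - A + f₂)) ∧
          (A + f₀ < d → d ≤ A + B → k = n - 2 * m * (ε - υ - 1))) ∧
        -- (2)
        (f₃ ≠ 0 → A + B < d → d ≤ A + B + f₃ * Q →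
          ∀ a : ℤ, 0 ≤ a → a ≤ f₃ - 1 →
            (A + B + a * Q < d → d ≤ A + (a + 1) * Q →
              k = n - 2 * m * (ε - υ - 2 * a - 2)) ∧
            (A + (a + 1) * Q < d → d ≤ A + B + (a + 1) * Q →
              k = n - 2 * m * (ε - υ - 2 * a - 3))) ∧
        -- (3)
        (A + B + f₃ * Q < d → d ≤ (2 * (q : ℤ) ^ (t + 1) + 2 * q - 1) / lam + 1 →
          -- (i)
          (f₁ = f₃ →
            (A + B + f₃ * Q < d → d ≤ κ → k = n - 2 * m * (ε - υ - 2 * f₁ - 2)) ∧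
            (κ < d → d ≤ (2 * (q : ℤ) ^ (t + 1) + 2 * q - 1) / lam + 1 →
              k = n - 2 * m * (τ - υ - 2 * f₁ - 2))) ∧
          -- (ii)
          (f₁ = f₃ + 1 →
            (A + B + f₃ * Q < d → d ≤ A + f₁ * Q → k = n - 2 * m * (ε - υ - 2 * f₁)) ∧
            (A + f₁ * Q < d → d ≤ κ → k = n - 2 * m * (ε - υ - 2 * f₁ - 1)) ∧
            (κ < d → d ≤ (2 * (q : ℤ) ^ (t + 1) + 2 * q - 1) / lam + 1 →
              k = n - 2 * m * (τ - υ - 2 * f₁ - 1))))) := by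
  classical
  intro d A B Q f₀ f₁ f₂ f₃ υ ε κ τ
  obtain ⟨D, rfl⟩ : ∃ D, δ = D + 1 := ⟨δ - 1, by omega⟩
  subst hm
  have hcardF : 1 < q := hq ▸ Fintype.one_lt_card
  have hq3 : 3 ≤ q := by obtain ⟨r, hr⟩ := hq_odd; omega
  have ht3 : 3 ≤ t := by obtain ⟨r, hr⟩ := ht; omega
  have hl0 : 0 < lam := by omega
  have hlN : lam ∣ q ^ (2 * t + 1) + 1 := by
    have h1 := Odd.nat_add_dvd_pow_add_pow q 1 (odd_two_mul_add_one t)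
    rw [one_pow] at h1
    exact hlam.trans h1
  have hN : n * lam = q ^ (2 * t + 1) + 1 := by rw [hn]; exact Nat.div_mul_cancel hlN
  have hlam2' : 2 * lam ≤ q + 1 := by
    obtain ⟨c, hc⟩ := hlam
    have : 2 ≤ c := by
      by_contra hlt
      have : c = 0 ∨ c = 1 := by omega
      rcases this with rfl | rfl <;> omega
    rw [hc, mul_comm]
    exact Nat.mul_le_mul_left lam this
  have hq3Z : (3 : ℤ) ≤ q := by exact_mod_cast hq3
  have hl2Z : (2 : ℤ) ≤ lam := by exact_mod_cast hlam2
  have hl0Z : (0 : ℤ) < lam := by linarith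
  have hlqZ : (lam : ℤ) ∣ q + 1 := by exact_mod_cast hlam
  have hlqZ' : 2 * (lam : ℤ) ≤ q + 1 := by exact_mod_cast hlam2'
  have hlQ : (lam : ℤ) ∣ Q + 1 := by
    have h1 := ht.add_dvd_pow_add_pow (q : ℤ) 1
    rw [one_pow] at h1
    exact hlqZ.trans h1
  have hQ9 : 9 * (q : ℤ) ≤ Q := nine_mul_le_pow hq3Z ht3
  have hQ0 : 0 < Q := by linarith
  have hA : (lam : ℤ) * A = Q * q - 1 := by
    have h1 : (lam : ℤ) ∣ (q : ℤ) ^ (t + 1) - 1 := by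
      have := dvd_sub (hlQ.mul_right (q : ℤ)) hlqZ
      rwa [show (Q + 1) * (q : ℤ) - (q + 1) = (q : ℤ) ^ (t + 1) - 1 by
        simp only [Q]; ring] at this
    exact (Int.mul_ediv_cancel' h1).trans (by simp only [Q]; ring)
  have hB : (lam : ℤ) * B = 2 * (Q + 1) := Int.mul_ediv_cancel' (hlQ.mul_left 2)
  have hD : (lam : ℤ) * D ≤ 2 * (Q * q) + 2 * q - 1 := by
    rw [Nat.cast_add, Nat.cast_one, add_sub_cancel_right, Int.le_ediv_iff_mul_le hl0Z] at hδ2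
    calc (lam : ℤ) * D = D * lam := mul_comm _ _
      _ ≤ _ := hδ2
      _ = 2 * (Q * q) + 2 * q - 1 := by simp only [Q]; ring
  have hf₀ : 0 ≤ f₀ := Int.ediv_nonneg (by linarith) hl0Z.le
  have hf₂ : 0 ≤ f₂ := Int.ediv_nonneg (by linarith) hl0Z.le
  have hf₃ : 0 ≤ f₃ := Int.ediv_nonneg (by linarith) hl0Z.le
  have hf₁ : 1 ≤ f₁ := (Int.le_ediv_iff_mul_le hl0Z).2 (by linarith)
  have hf₃₁ : f₃ ≤ f₁ := Int.ediv_le_ediv hl0Z (by linarith)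
  have hf₀l : (lam : ℤ) * f₀ ≤ q := Int.mul_ediv_self_le hl0Z.ne'
  have hf₁l : (lam : ℤ) * f₁ ≤ q - 1 := Int.mul_ediv_self_le hl0Z.ne'
  have hf₂l : (lam : ℤ) * f₂ ≤ q - 2 := Int.mul_ediv_self_le hl0Z.ne'
  have hf₃l : (lam : ℤ) * f₃ ≤ q - 3 := Int.mul_ediv_self_le hl0Z.ne'
  have hgl : (lam : ℤ) * ((2 * (q : ℤ) - 3) / lam) ≤ 2 * q - 3 :=
    Int.mul_ediv_self_le hl0Z.ne'
  have hlow : 1 ≤ A - f₂ := by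
    have : (lam : ℤ) * 0 < lam * (A - f₂) := by
      rw [mul_sub, hA, mul_zero]
      linarith [le_mul_of_one_le_left (by linarith : (0 : ℤ) ≤ q) (by linarith : 1 ≤ Q)]
    exact lt_of_mul_lt_mul_left this hl0Z.le
  have hκl : 2 * (Q * q) - 2 * q + 1 ≤ (lam : ℤ) * κ := by
    simp only [κ]
    rw [mul_sub, mul_left_comm (lam : ℤ), hA]; linarith
  have hκ₁ : A + f₁ * Q < κ := by
    refine lt_of_mul_lt_mul_left (lt_of_lt_of_le ?_ hκl) hl0Z.le
    have : (lam : ℤ) * f₁ * Q ≤ (q - 1) * Q := by gcongr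
    rw [mul_add, hA, ← mul_assoc]; linarith
  have hκ₂ : A + B + f₃ * Q < κ := by
    refine lt_of_mul_lt_mul_left (lt_of_lt_of_le ?_ hκl) hl0Z.le
    have : (lam : ℤ) * f₃ * Q ≤ (q - 3) * Q := by gcongr
    rw [mul_add, mul_add, hA, hB, ← mul_assoc]; linarith
  have hf₀B : f₀ < B :=
    lt_of_mul_lt_mul_left (show (lam : ℤ) * f₀ < lam * B by rw [hB]; linarith) hl0Z.le
  have hf₀Q : f₀ < Q := (Int.ediv_le_self _ (by linarith)).trans_lt (by linarith)
  have hB2 : lam = 2 → B = Q + 1 := fun h => by rw [h] at hB; push_cast at hB; linarith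
  have hBQ : lam ≠ 2 → B ≤ Q := fun h => by
    have h3 : (3 : ℤ) ≤ lam := by omega
    have : (lam : ℤ) * B ≤ lam * Q := by
      rw [hB]
      linarith [mul_le_mul_of_nonneg_right h3 hQ0.le]
    exact le_of_mul_le_mul_left this hl0Z
  have hf₁2 : lam = 2 → f₁ = ((q : ℤ) - 1) / 2 := fun h => by simp only [f₁, h, Nat.cast_ofNat]
  have hf₃2 : lam = 2 → f₃ = f₁ - 1 := fun h => by simp only [f₁, f₃, h, Nat.cast_ofNat]; omega
  obtain ⟨L, hLdef⟩ : ∃ L : ℕ → ℕ,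
    ∀ C, L C = ((Finset.Ico 1 (C + 1)).filter (IsLeader q t lam)).card := ⟨_, fun _ => rfl⟩
  have hcount : ∀ (C : ℕ) (x y : ℤ), (C : ℤ) < κ → 0 ≤ x → x ≤ f₁ → (0 < x → A + x * Q ≤ C) →
      (x = f₁ ∨ (C : ℤ) < A + (x + 1) * Q) → 0 ≤ y → y ≤ f₃ + 1 →
      (0 < y → A + B + (y - 1) * Q ≤ C) → (y = f₃ + 1 ∨ (C : ℤ) < A + B + y * Q) →
      (L C : ℤ) = C - (C : ℤ) / q - (Finset.Icc (A - f₂) (min (C : ℤ) (A + f₀))).card - x - y :=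
    fun C x y => by rw [hLdef]; exact card_filter_isLeader hq3 ht3 hlam2 hlqZ hlQ hA hB hlow
  have hconst : ∀ C : ℕ, κ ≤ C + 1 → C ≤ D → L D = L C := fun C h h' => by
    rw [hLdef, hLdef, card_filter_isLeader_of_le hlam2 hA h h']
  have hε : ε = D - (D : ℤ) / q := by
    have := ceil_mul_one_sub_inv q (D : ℤ)
    simp only [ε, d]
    rw [← this]
    push_cast
    rw [add_sub_cancel_right]
  have hτ : τ = (κ - 1) - (κ - 1) / q := by
    have := ceil_mul_one_sub_inv q (κ - 1)
    simp only [τ]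
    rw [← this]
    push_cast
    rfl
  have hd : d - 1 = D := by simp only [d]; push_cast; ring
  have hparam := bchCode_parameters hq hq3 ht3 ht hlam hlam2 hlam2' hN hβ hD rfl
  rw [← hLdef] at hparam
  refine ⟨(n : ℤ) - 2 * ((2 * t + 1 : ℕ) : ℤ) * (L D : ℤ), hparam.1, hparam.2, ?_⟩
  clear_value A B Q f₀ f₁ f₂ f₃ ε κ τ d
  have hL : ∀ x y : ℤ, d - 1 < κ → 0 ≤ x → x ≤ f₁ → (0 < x → A + x * Q ≤ d - 1) →
      (x = f₁ ∨ d - 1 < A + (x + 1) * Q) → 0 ≤ y → y ≤ f₃ + 1 →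
      (0 < y → A + B + (y - 1) * Q ≤ d - 1) → (y = f₃ + 1 ∨ d - 1 < A + B + y * Q) →
      (L D : ℤ) = ε - (Finset.Icc (A - f₂) (min (d - 1) (A + f₀))).card - x - y := by
    rw [hd, hε]
    exact hcount D
  have hLκ : κ ≤ d - 1 → (L D : ℤ) = τ - (f₂ + f₀ + 1) - f₁ - (f₃ + 1) := by
    intro h
    rw [hd] at h
    have hf₃Q : 0 ≤ f₃ * Q := mul_nonneg hf₃ hQ0.le
    -- The count is frozen at its value at `κ - 1`, where the window and both families of isolated
    -- points have been passed completely.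
    obtain ⟨C, hC⟩ : ∃ C : ℕ, (C : ℤ) = κ - 1 := Int.eq_ofNat_of_zero_le (by linarith) |>.imp
      fun _ h => h.symm
    rw [hconst C (by linarith) (by zify; linarith), hcount C f₁ (f₃ + 1) (by linarith) (by linarith)
      le_rfl (fun _ => by linarith) (Or.inl rfl) (by linarith) le_rfl (fun _ => by linarith)
      (Or.inl rfl), hC, hτ, min_eq_right (by linarith), Int.card_Icc, Int.toNat_of_nonneg (by linarith)]
    ring
  have key := dimension_formula (n := n) (m := (2 * t + 1 : ℕ))
    (M := (2 * (q : ℤ) ^ (t + 1) + 2 * q - 1) / lam + 1) hQ0 hB2 hBQ hf₁2 hf₃2 hf₃₁ hf₃ hf₁ hf₀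
    hf₂ hf₀B hf₀Q hκ₁ hκ₂ hL hLκ
  exact key
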